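/- Let $n\ge 2$ and $m\ge 0$ be integers. For a tempered distribution $f\in\mathcal S'(\mathbf R^n;\mathbf C^m)$ let $\hat f$ be its Fourier transform, normalized by $\hat\varphi(\xi)=(2\pi)^{-n/2}\int e^{-ix\cdot\xi}\varphi(x)\,dx$ on Schwartz functions. **Kernels.** A *majorizing kernel with exponent* $\theta\ge 0$ is a function $h:\mathbf R^n\to(0,\infty]$ that is a tempered distribution (locally integrable), is finite almost everywhere, and satisfies, for some constant $B>0$, $$\int_{\mathbf R^n}h(\xi-\eta)h(\eta)\,d\eta\le B|\xi|^\theta h(\xi)\qquad(\xi\ne 0).$$ For $\alpha\ge 0$ and $\omega>0$, $\mathcal H^\theta_{\alpha,\omega}(\mathbf R^n)$ is the class of those majorizing kernels $h$ with exponent $\theta$ such that $h(\xi)=O(|\xi|^{-\alpha})$ and $|\xi|^{-\alpha}=O(h(\xi))$ as $\xi\to0$, $h(\xi)=O(|\xi|^{-\omega})$ and $|\xi|^{-\omega}=O(h(\xi))$ as $\xi\to\infty$, and $h$ is bounded on the complement of every neighbourhood of the origin. **Spaces.** All spaces consist of the $f\in\mathcal S'(\mathbf R^n;\mathbf C^m)$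 for which the norm is finite; for the first two it is also required that $\hat f\in L^1_{\rm loc}$: $$\|f\|_{\mathcal F_h}=\operatorname*{ess\,sup}_\xi h(\xi)^{-1}|\hat f(\xi)|,\qquad \|f\|_{PM^a}=\operatorname*{ess\,sup}_\xi|\xi|^a|\hat f(\xi)|,$$ $$\|f\|_{BMO^{-1}}=\sup_{x\in\mathbf R^n,\;R>0}\Big(\frac1{|B(x,R)|}\int_0^{R^2}\!\!\int_{B(x,R)}|e^{t\Delta}f|^2\,dy\,dt\Big)^{1/2},$$ and $\|f\|_{BMO_T^{-1}}$, $T>0$, is defined by the same formula with the supremum taken only over $x\in\mathbf R^n$ and $R>0$ with $R^2<T$. Here $e^{t\Delta}f$ is the convolution of $f$ with the heat kernel $(4\pi t)^{-n/2}e^{-|x|^2/(4t)}$. We write $X\hookrightarrow Y$ if $X\subseteq Y$ and $\|f\|_Y\le C\|f\|_X$ for all $f\in X$, with a constant $C$ independent of $f$. **Theorem.** 1. If $h\in\mathcal H^1_{\alpha,\omega}(\mathbf R^n)$ for some $\alpha\ge0$, $\omega>0$, then $\mathcal F_h\hookrightarrow PM^{n-1}$; moreover $PM^{n-1}\hookrightarrow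 BMO^{-1}$. 2. Let $0<\theta<1$. If $h\in\mathcal H^\theta_{\alpha,\omega}(\mathbf R^n)$ for some $\alpha\ge0$, $\omega>0$, then $\mathcal F_h\hookrightarrow PM^{n-\theta}$; moreover $PM^{n-\theta}\hookrightarrow BMO_T^{-1}$ for all $T>0$, and there is a constant $C$, independent of $T$, $h$ and $f$, such that $$\|f\|_{BMO_T^{-1}}\le C\,T^{(1-\theta)/2}\,\|f\|_{PM^{n-\theta}}\qquad\text{for all }T>0,\ f\in PM^{n-\theta}.$$ -/

import Mathlib

open MeasureTheory Filter Topology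
open scoped SchwartzMap FourierTransform ENNReal NNReal

noncomputable section

namespace Majorization

/-- `ℝⁿ` with its Euclidean norm. -/
abbrev Space (n : ℕ) : Type := EuclideanSpace ℝ (Fin n)

/-- `ℂᵐ` with its Euclidean norm. -/
abbrev Vec (m : ℕ) : Type := EuclideanSpace ℂ (Fin m)

/-! ### Tempered distributions and functions, the Fourier transform -/

/-- The tempered distribution `T` is the locally integrable function `g`: the two agree as
distributions, that is, on smooth compactly supported test functions. -/
def IsFunction {n : ℕ} {F : Type*} [NormedAddCommGroup F] [NormedSpace ℂ F]
    (T : 𝓢'(Space n, F)) (g : Space n → F) : Prop :=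
  LocallyIntegrable g volume ∧
    ∀ φ : 𝓢(Space n, ℂ), HasCompactSupport φ → T φ = ∫ ξ, φ ξ • g ξ

/-- The dilation `ξ ↦ (2π)⁻¹ ξ` of `ℝⁿ`. -/
def dilation (n : ℕ) : Space n ≃L[ℝ] Space n :=
  ContinuousLinearEquiv.smulLeft (Units.mk0 ((2 * Real.pi)⁻¹) (by positivity))

/-- The unitary Fourier transform with angular frequency on Schwartz functions,
`φ̂(ξ) = (2π)^{-n/2} ∫ e^{-i x·ξ} φ(x) dx`, obtained from Mathlib's
`𝓕 φ (ξ) = ∫ e^{-2πi x·ξ} φ(x) dx` by the dilation `ξ ↦ (2π)⁻¹ ξ`. -/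
def schwartzFourier (n : ℕ) : 𝓢(Space n, ℂ) →L[ℂ] 𝓢(Space n, ℂ) :=
  (((2 * Real.pi) ^ (-(n : ℝ) / 2) : ℝ) : ℂ) •
    ((SchwartzMap.compCLMOfContinuousLinearEquiv ℂ (dilation n)).comp
      (FourierTransform.fourierCLM ℂ 𝓢(Space n, ℂ)))

/-- The formula for the Fourier transform of a Schwartz function. -/
theorem schwartzFourier_apply (n : ℕ) (φ : 𝓢(Space n, ℂ)) (ξ : Space n) :
    schwartzFourier n φ ξ = (((2 * Real.pi) ^ (-(n : ℝ) / 2) : ℝ) : ℂ) *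
      ∫ x, Complex.exp (-(Complex.I * ((inner ℝ x ξ : ℝ) : ℂ))) * φ x := by
  have h1 : schwartzFourier n φ ξ = (((2 * Real.pi) ^ (-(n : ℝ) / 2) : ℝ) : ℂ) *
      𝓕 (φ : Space n → ℂ) ((2 * Real.pi)⁻¹ • ξ) := rfl
  rw [h1, Real.fourier_eq']
  congr 2
  funext x
  rw [smul_eq_mul, inner_smul_right]
  congr 2
  push_cast
  have : (Real.pi : ℂ) ≠ 0 := by exact_mod_cast Real.pi_ne_zero
  field_simp

/-- The Fourier transform of a tempered distribution, `⟨f̂, φ⟩ = ⟨f, φ̂⟩`. -/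
def fourierDist {n m : ℕ} (f : 𝓢'(Space n, Vec m)) : 𝓢'(Space n, Vec m) :=
  PointwiseConvergenceCLM.precomp (Vec m) (schwartzFourier n) f

/-! ### Majorizing kernels -/

/-- A majorizing kernel `h : ℝⁿ → (0, ∞]` with exponent `θ`.  At `ξ = 0` the right-hand side of the
convolution inequality is the undefined product `0 · ∞` when `θ > 0` and `h 0 = ∞` (for instance
for `h ξ = |ξ|^{-(n-θ)}`), so the inequality is imposed at the points `ξ ≠ 0`. -/
structure IsMajorizingKernel (n : ℕ) (θ : ℝ) (h : Space n → ℝ≥0∞) : Prop where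
  exponent_nonneg : 0 ≤ θ
  pos : ∀ ξ, 0 < h ξ
  tempered : ∃ T : 𝓢'(Space n, ℂ), IsFunction T (fun ξ => ((h ξ).toReal : ℂ))
  conv_le : ∃ B : ℝ≥0, 0 < B ∧ ∀ ξ : Space n, ξ ≠ 0 →
    ∫⁻ η, h (ξ - η) * h η ≤ B * ENNReal.ofReal (‖ξ‖ ^ θ) * h ξ
  infinite_null : volume {ξ | h ξ = ∞} = 0

/-- `h` behaves like `|ξ|^{-a}` along the filter `l`: each of the two functions is `O` of the
other. -/
def BehavesLike {n : ℕ} (l : Filter (Space n)) (h : Space n → ℝ≥0∞) (a : ℝ) : Prop :=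
  (∃ C : ℝ≥0, ∀ᶠ ξ in l, h ξ ≤ C * ENNReal.ofReal (‖ξ‖ ^ (-a))) ∧
    ∃ C : ℝ≥0, ∀ᶠ ξ in l, ENNReal.ofReal (‖ξ‖ ^ (-a)) ≤ C * h ξ

/-- Majorizing kernels with exponent `θ` and radial algebraic growth and decay: they behave as
`|ξ|^{-α}` at the origin, as `|ξ|^{-ω}` at infinity, and are bounded off every neighbourhood of the
origin. -/
structure IsRadialAlgebraicKernel (n : ℕ) (θ α ω : ℝ) (h : Space n → ℝ≥0∞) : Prop
    extends IsMajorizingKernel n θ h where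
  alpha_nonneg : 0 ≤ α
  omega_pos : 0 < ω
  origin : BehavesLike (𝓝[≠] 0) h α
  infinity : BehavesLike (cocompact (Space n)) h ω
  bounded : ∀ U ∈ 𝓝 (0 : Space n), ∃ C : ℝ≥0, ∀ ξ ∉ U, h ξ ≤ C

/-! ### The function spaces

Each space consists of the tempered distributions at which its extended norm is finite. -/

/-- The extended norm of the majorization space `F_h`: the essential supremum of `h⁻¹ |f̂|` if `f̂`
is a locally integrable function (which is then unique almost everywhere), and `∞` otherwise. -/
def majorizationNorm {n m : ℕ} (h : Space n → ℝ≥0∞) (f : 𝓢'(Space n, Vec m)) : ℝ≥0∞ :=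
  ⨅ (g : Space n → Vec m) (_ : IsFunction (fourierDist f) g),
    essSup (fun ξ => (h ξ)⁻¹ * ‖g ξ‖ₑ) volume

/-- The extended norm of the pseudomeasure space `PM^a`: the essential supremum of `|ξ|^a |f̂(ξ)|`
if `f̂` is a locally integrable function, and `∞` otherwise. -/
def pmNorm {n m : ℕ} (a : ℝ) (f : 𝓢'(Space n, Vec m)) : ℝ≥0∞ :=
  ⨅ (g : Space n → Vec m) (_ : IsFunction (fourierDist f) g),
    essSup (fun ξ => ENNReal.ofReal (‖ξ‖ ^ a) * ‖g ξ‖ₑ) volume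

/-- A polynomial times a Gaussian is bounded. -/
theorem poly_mul_gaussian_le (a : ℝ) (ha : 0 < a) (M : ℕ) (r : ℝ) (hr : 0 ≤ r) :
    (1 + r) ^ M * Real.exp (-(a * r ^ 2)) ≤ Real.exp a * (M.factorial * (2 / a) ^ M) := by
  have h1 : (a * (1 + r) ^ 2 / 2) ^ M / M.factorial ≤ Real.exp (a * (1 + r) ^ 2 / 2) :=
    Real.pow_div_factorial_le_exp _ (by positivity) M
  have h2 : Real.exp (-(a * r ^ 2)) ≤ Real.exp a * Real.exp (-(a * (1 + r) ^ 2 / 2)) := by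
    rw [← Real.exp_add]
    apply Real.exp_le_exp.2
    nlinarith [sq_nonneg (r - 1), mul_nonneg ha.le (sq_nonneg (r - 1))]
  have h3 : (1 + r) ^ M ≤ ((1 + r) ^ 2) ^ M := by
    rw [← pow_mul]
    exact pow_le_pow_right₀ (by linarith) (by omega)
  have h4 : ((1 + r) ^ 2) ^ M =
      (M.factorial * (2 / a) ^ M) * ((a * (1 + r) ^ 2 / 2) ^ M / M.factorial) := by
    have : (M.factorial : ℝ) ≠ 0 := by exact_mod_cast M.factorial_ne_zero
    have h5 : (1 + r) ^ 2 = (2 / a) * (a * (1 + r) ^ 2 / 2) := by field_simp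
    rw [mul_assoc, mul_div_assoc', ← mul_pow, ← h5, mul_div_cancel₀ _ this]
  calc (1 + r) ^ M * Real.exp (-(a * r ^ 2))
      ≤ ((M.factorial * (2 / a) ^ M) * Real.exp (a * (1 + r) ^ 2 / 2)) *
          (Real.exp a * Real.exp (-(a * (1 + r) ^ 2 / 2))) := by
        rw [h4] at h3
        gcongr
        exact h3.trans (by gcongr)
    _ = Real.exp a * (M.factorial * (2 / a) ^ M) := by
        rw [Real.exp_neg]
        field_simp

/-- Gaussians satisfy the Schwartz decay estimates. -/
theorem gaussian_decay (n : ℕ) (a : ℝ) (ha : 0 < a) (k l : ℕ) :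
    ∃ C : ℝ, ∀ x : Space n,
      ‖x‖ ^ k * ‖iteratedFDeriv ℝ l (fun x : Space n => Real.exp (-(a * ‖x‖ ^ 2))) x‖ ≤ C := by
  have hgrow : (fun x : Space n => -(a * ‖x‖ ^ 2)).HasTemperateGrowth :=
    ((Function.HasTemperateGrowth.const a).mul
      (Function.hasTemperateGrowth_norm_sq (H := Space n))).neg
  obtain ⟨p, K, hK, hb⟩ := hgrow.norm_iteratedFDeriv_le_uniform l
  refine ⟨l.factorial * (1 + K) ^ l *
    (Real.exp a * ((k + p * l).factorial * (2 / a) ^ (k + p * l))), fun x => ?_⟩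
  have hx : 1 ≤ 1 + ‖x‖ := by linarith [norm_nonneg x]
  have hD1 : 1 ≤ (1 + K) * (1 + ‖x‖) ^ p :=
    one_le_mul_of_one_le_of_one_le (by linarith) (one_le_pow₀ hx)
  have hmain := norm_iteratedFDeriv_comp_le (𝕜 := ℝ) (g := Real.exp)
    (f := fun x : Space n => -(a * ‖x‖ ^ 2)) (n := l) (N := ((⊤ : ℕ∞) : WithTop ℕ∞)) Real.contDiff_exp hgrow.1
    (by exact_mod_cast le_top) x (C := Real.exp (-(a * ‖x‖ ^ 2)))
    (D := (1 + K) * (1 + ‖x‖) ^ p)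
    (fun i _ => by
      rw [norm_iteratedFDeriv_eq_norm_iteratedDeriv, iteratedDeriv_eq_iterate, Real.iter_deriv_exp,
        Real.norm_of_nonneg (Real.exp_pos _).le])
    (fun i hi hil => (hb i hil x).trans <|
      (mul_le_mul_of_nonneg_right (by linarith) (by positivity)).trans
        (le_self_pow₀ hD1 (by omega)))
  calc ‖x‖ ^ k * ‖iteratedFDeriv ℝ l (fun x : Space n => Real.exp (-(a * ‖x‖ ^ 2))) x‖
      ≤ (1 + ‖x‖) ^ k * (l.factorial * Real.exp (-(a * ‖x‖ ^ 2)) *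
          ((1 + K) * (1 + ‖x‖) ^ p) ^ l) := by
        gcongr
        · linarith
        · exact hmain
    _ = l.factorial * (1 + K) ^ l *
          ((1 + ‖x‖) ^ (k + p * l) * Real.exp (-(a * ‖x‖ ^ 2))) := by
        rw [mul_pow, ← pow_mul, pow_add]
        ring
    _ ≤ _ := mul_le_mul_of_nonneg_left (poly_mul_gaussian_le a ha _ _ (norm_nonneg x))
        (by positivity)

/-- The Gaussian `x ↦ e^{-a|x|²}`, `a > 0`, as a Schwartz function. -/
def gaussian (n : ℕ) (a : ℝ) (ha : 0 < a) : 𝓢(Space n, ℝ) where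
  toFun x := Real.exp (-(a * ‖x‖ ^ 2))
  smooth' := Real.contDiff_exp.comp ((contDiff_const.mul (contDiff_norm_sq ℝ)).neg)
  decay' := gaussian_decay n a ha

/-- The heat kernel centred at `y`, `x ↦ (4πt)^{-n/2} e^{-|x-y|²/(4t)}`, as a Schwartz function;
it is used for `t > 0` only. -/
def heatKernel (n : ℕ) (t : ℝ) (y : Space n) : 𝓢(Space n, ℂ) :=
  if ht : 0 < t then
    (((4 * Real.pi * t) ^ (-(n : ℝ) / 2) : ℝ) : ℂ) •
      SchwartzMap.compSubConstCLM ℂ y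
        (SchwartzMap.postcompCLM Complex.ofRealCLM (gaussian n (1 / (4 * t)) (by positivity)))
  else 0

/-- The formula for the heat kernel. -/
theorem heatKernel_apply (n : ℕ) (t : ℝ) (ht : 0 < t) (y x : Space n) :
    heatKernel n t y x =
      (((4 * Real.pi * t) ^ (-(n : ℝ) / 2) * Real.exp (-(‖x - y‖ ^ 2 / (4 * t))) : ℝ) : ℂ) := by
  have h1 : heatKernel n t y x = (((4 * Real.pi * t) ^ (-(n : ℝ) / 2) : ℝ) : ℂ) *
      ((Real.exp (-(1 / (4 * t) * ‖x - y‖ ^ 2)) : ℝ) : ℂ) := by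
    simp only [heatKernel, ht, dif_pos]
    rfl
  rw [h1, ← Complex.ofReal_mul, one_div, inv_mul_eq_div]

/-- The caloric extension `(e^{tΔ} f)(y)`, `t > 0`, of a tempered distribution: the pairing of `f`
with the heat kernel centred at `y`. -/
def heat {n m : ℕ} (f : 𝓢'(Space n, Vec m)) (t : ℝ) (y : Space n) : Vec m :=
  f (heatKernel n t y)

/-- `( |B(x,R)|⁻¹ ∫_0^{R²} ∫_{B(x,R)} |e^{tΔ} f|² dy dt )^{1/2}`. -/
def carleson {n m : ℕ} (f : 𝓢'(Space n, Vec m)) (x : Space n) (R : ℝ) : ℝ≥0∞ :=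
  ((volume (Metric.ball x R))⁻¹ *
    ∫⁻ t in Set.Ioo 0 (R ^ 2), ∫⁻ y in Metric.ball x R, ‖heat f t y‖ₑ ^ 2) ^ (1 / 2 : ℝ)

/-- The extended norm of `BMO⁻¹`. -/
def bmoInvNorm {n m : ℕ} (f : 𝓢'(Space n, Vec m)) : ℝ≥0∞ :=
  ⨆ (x : Space n) (R : ℝ) (_ : 0 < R), carleson f x R

/-- The extended norm of `BMO_T⁻¹`: only the balls with `R² < T` are considered. -/
def bmoInvNormLocal {n m : ℕ} (T : ℝ) (f : 𝓢'(Space n, Vec m)) : ℝ≥0∞ :=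
  ⨆ (x : Space n) (R : ℝ) (_ : 0 < R) (_ : R ^ 2 < T), carleson f x R

/-- The space `{N₁ < ∞}` is continuously embedded in the space `{N₂ < ∞}`: it is contained in it,
and the inclusion is bounded. -/
def ContinuouslyEmbeds {n m : ℕ} (N₁ N₂ : 𝓢'(Space n, Vec m) → ℝ≥0∞) : Prop :=
  (∀ f, N₁ f < ∞ → N₂ f < ∞) ∧ ∃ C : ℝ≥0, ∀ f, N₁ f < ∞ → N₂ f ≤ C * N₁ f

end Majorization

end

noncomputable section

namespace Majorization

/-! Two independent estimates meet in $PM^{n-\theta}$.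

Kernels: in the convolution inequality at $\xi$, keep only the $\eta$ in the ball of radius
$|\xi|/4$ about $\xi/2$, where $\eta$ and $\xi-\eta$ both have size comparable to $|\xi|$. If
$h\sim|\xi|^{-a}$ at this scale, the inequality becomes $|\xi|^{n-2a}\lesssim|\xi|^{\theta-a}$, so
$|\xi|^{n-\theta-a}$ stays bounded (`exists_rpow_le_of_conv_le`). Letting $\xi\to0$ and
$\xi\to\infty$ gives $\alpha\le n-\theta\le\omega$. Since $h$ is bounded in between,
$h\lesssim|\xi|^{-(n-\theta)}$ (`IsRadialAlgebraicKernel.le_rpow`), which is the first embedding.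

Carleson bound: let $|\hat f|\le M|\xi|^{-(n-\theta)}$ and split $e^{t\Delta}f$ at frequency $1/R$
(`lintegral_heat_sq_le`). The low part is at most a constant times
$M\int_{|\xi|<1/R}|\xi|^{-(n-\theta)}\,d\xi\sim MR^{-\theta}$ pointwise, which needs $\theta>0$. For
the high part, enlarge $B(x,R)$ to $\mathbf R^n$ and apply Plancherel; the time integral of
$e^{-2t|\xi|^2}$ gains $|\xi|^{-2}$, leaving $M^2\int_{|\xi|\ge1/R}|\xi|^{-2(n-\theta)-2}\,d\xi\sim
M^2R^{n+2-2\theta}$. After averaging, both parts contribute $M^2R^{2(1-\theta)}$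
(`exists_carleson_le`). This is scale invariant for $\theta=1$, and at most $M^2T^{1-\theta}$ when
$R^2<T$ and $\theta<1$.

Two facts make the frequency side rigorous: the pairing with $\hat f$, given only on compactly
supported test functions, extends to Gaussians (`IsFunction.apply_eq_integral`), and Plancherel
holds for the actual Fourier integral (`eLpNorm_fourier_eq`). -/

/-! ### Exponents of radial algebraic kernels and the embedding into $PM^{n-\theta}$ -/

/-- If `h` is comparable to `|ξ|^{-a}` on the relevant points, the convolution inequality bounds
`|ξ|^{n-θ-a}`. -/
theorem exists_rpow_le_of_conv_le {n : ℕ} {θ a : ℝ} {h : Space n → ℝ≥0∞} (ha : 0 ≤ a)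
    {B C₁ C₂ : ℝ≥0} (hconv : ∀ ξ : Space n, ξ ≠ 0 →
      ∫⁻ η, h (ξ - η) * h η ≤ B * ENNReal.ofReal (‖ξ‖ ^ θ) * h ξ) :
    ∃ K : ℝ, ∀ ξ : Space n, ξ ≠ 0 → h ξ ≤ C₁ * ENNReal.ofReal (‖ξ‖ ^ (-a)) →
      (∀ η, ‖ξ‖ / 4 ≤ ‖η‖ → ‖η‖ ≤ ‖ξ‖ → ENNReal.ofReal (‖η‖ ^ (-a)) ≤ C₂ * h η) →
      ‖ξ‖ ^ ((n : ℝ) - θ - a) ≤ K := by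
  set v : ℝ := (volume (Metric.ball (0 : Space n) 1)).toReal with hv
  have hvtop : volume (Metric.ball (0 : Space n) 1) ≠ ∞ := measure_ball_lt_top.ne
  have hvpos : 0 < v := ENNReal.toReal_pos (Metric.measure_ball_pos _ _ one_pos).ne' hvtop
  -- Two lower bounds for $h$, the kernel constant and one upper bound; $4^n/v$ is $|\xi|^n$ divided
  -- by the volume of the ball of radius $|\xi|/4$.
  refine ⟨(C₂ * C₂ * B * C₁ : ℝ) * (4 ^ n / v), fun ξ hξ hup hlow => ?_⟩
  have hξ0 : 0 < ‖ξ‖ := norm_pos_iff.2 hξ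
  have hmem : ∀ η ∈ Metric.ball ((1 / 2 : ℝ) • ξ) (‖ξ‖ / 4), ‖ξ‖ / 4 ≤ ‖η‖ ∧ ‖η‖ ≤ ‖ξ‖ := by
    intro η hη
    rw [mem_ball_iff_norm] at hη
    have h1 : ‖(1 / 2 : ℝ) • ξ‖ = ‖ξ‖ / 2 := by rw [norm_smul]; norm_num; ring
    have h2 := norm_sub_norm_le η ((1 / 2 : ℝ) • ξ)
    have h3 := norm_sub_norm_le ((1 / 2 : ℝ) • ξ) η
    rw [norm_sub_rev] at h3
    constructor <;> linarith
  -- The ball is centred at the midpoint of $0$ and $\xi$, so $\eta\mapsto\xi-\eta$ preserves it and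
  -- one lower bound serves both factors.
  have hrefl : ∀ η ∈ Metric.ball ((1 / 2 : ℝ) • ξ) (‖ξ‖ / 4),
      ξ - η ∈ Metric.ball ((1 / 2 : ℝ) • ξ) (‖ξ‖ / 4) := by
    intro η hη
    rw [mem_ball_iff_norm] at hη ⊢
    have : ξ - η - (1 / 2 : ℝ) • ξ = -(η - (1 / 2 : ℝ) • ξ) := by module
    rwa [this, norm_neg]
  have hpt : ∀ η ∈ Metric.ball ((1 / 2 : ℝ) • ξ) (‖ξ‖ / 4),
      ENNReal.ofReal (‖ξ‖ ^ (-a)) ≤ C₂ * h η := by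
    intro η hη
    obtain ⟨h1, h2⟩ := hmem η hη
    refine le_trans (ENNReal.ofReal_le_ofReal ?_) (hlow η h1 h2)
    exact Real.rpow_le_rpow_of_nonpos (by linarith) h2 (by linarith)
  set P : ℝ≥0∞ := ENNReal.ofReal (‖ξ‖ ^ (-a)) with hP
  have key : P * P * volume (Metric.ball ((1 / 2 : ℝ) • ξ) (‖ξ‖ / 4)) ≤
      C₂ * C₂ * ∫⁻ η, h (ξ - η) * h η := by
    rw [← setLIntegral_const, ← lintegral_const_mul' _ _ (by finiteness)]
    refine le_trans (setLIntegral_mono' measurableSet_ball fun η hη => ?_)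
      (setLIntegral_le_lintegral _ _)
    calc P * P ≤ (C₂ * h (ξ - η)) * (C₂ * h η) :=
          mul_le_mul' (hpt _ (hrefl η hη)) (hpt _ hη)
      _ = _ := by ring
  have key2 : P * P * volume (Metric.ball ((1 / 2 : ℝ) • ξ) (‖ξ‖ / 4)) ≤
      C₂ * C₂ * (B * ENNReal.ofReal (‖ξ‖ ^ θ) * (C₁ * P)) :=
    key.trans (by gcongr; exact (hconv ξ hξ).trans (by gcongr))
  rw [Measure.addHaar_ball_of_pos _ _ (by positivity), finrank_euclideanSpace_fin] at key2
  have key3 := ENNReal.toReal_mono (by finiteness) key2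
  simp only [ENNReal.toReal_mul, hP, ENNReal.coe_toReal] at key3
  rw [ENNReal.toReal_ofReal (by positivity), ENNReal.toReal_ofReal (by positivity),
    ENNReal.toReal_ofReal (by positivity), ← hv] at key3
  have e1 : ‖ξ‖ ^ ((n : ℝ) - θ - a) = ‖ξ‖ ^ n * ‖ξ‖ ^ (-a) / ‖ξ‖ ^ θ := by
    rw [← Real.rpow_natCast, ← Real.rpow_add hξ0, ← Real.rpow_sub hξ0]
    congr 1; ring
  have hA : 0 < ‖ξ‖ ^ (-a) := by positivity
  have hT : 0 < ‖ξ‖ ^ θ := by positivity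
  rw [e1, div_le_iff₀ hT]
  have h4 : (0 : ℝ) < 4 ^ n := by positivity
  rw [div_pow] at key3
  have : ‖ξ‖ ^ (-a) * (‖ξ‖ ^ n * ‖ξ‖ ^ (-a)) ≤
      ‖ξ‖ ^ (-a) * ((C₂ * C₂ * B * C₁ : ℝ) * (4 ^ n / v) * ‖ξ‖ ^ θ) := by
    have := mul_le_mul_of_nonneg_right key3 (by positivity : 0 ≤ 4 ^ n / v)
    calc _ = ‖ξ‖ ^ (-a) * ‖ξ‖ ^ (-a) * (‖ξ‖ ^ n / 4 ^ n * v) * (4 ^ n / v) := by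
          field_simp
      _ ≤ _ := this
      _ = _ := by ring
  exact le_of_mul_le_mul_left this hA

/-- The growth and decay exponents of a radial algebraic kernel are separated by `n - θ`. -/
theorem IsRadialAlgebraicKernel.exponents {n : ℕ} (hn : 1 ≤ n) {θ α ω : ℝ} {h : Space n → ℝ≥0∞}
    (H : IsRadialAlgebraicKernel n θ α ω h) : α ≤ n - θ ∧ n - θ ≤ ω := by
  obtain ⟨B, -, hB⟩ := H.conv_le
  have : NeZero n := ⟨by omega⟩
  obtain ⟨e, he⟩ : ∃ e : Space n, ‖e‖ = 1 := ⟨EuclideanSpace.single 0 1, by simp⟩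
  have hnorm : ∀ s : ℝ, 0 < s → ‖s • e‖ = s := fun s hs => by
    rw [norm_smul, he, mul_one, Real.norm_of_nonneg hs.le]
  have hne : ∀ s : ℝ, 0 < s → s • e ≠ 0 := fun s hs => by
    rw [← norm_pos_iff, hnorm s hs]; exact hs
  constructor
  · obtain ⟨⟨C₁, h1⟩, C₂, h2⟩ := H.origin
    obtain ⟨K, hK⟩ := exists_rpow_le_of_conv_le (C₁ := C₁) (C₂ := C₂) H.alpha_nonneg hB
    obtain ⟨δ, hδ, hU⟩ := Metric.mem_nhdsWithin_iff.1 (h1.and h2)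
    -- Otherwise $s^{n-\theta-\alpha}\to\infty$ as $s\to0^+$, against the uniform bound $K$.
    by_contra! hlt
    have ht : Tendsto (fun s : ℝ => s ^ ((n : ℝ) - θ - α)) (𝓝[>] 0) atTop :=
      tendsto_rpow_neg_nhdsGT_zero (by linarith)
    have hev := ht.eventually_gt_atTop K
    obtain ⟨s, hs, hsK⟩ := (hev.and (Ioo_mem_nhdsGT hδ)).exists
    have hs0 := hsK.1
    have hgood : ∀ η : Space n, η ≠ 0 → ‖η‖ ≤ s → η ∈ Metric.ball 0 δ ∩ {0}ᶜ := fun η h0 h3 =>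
      ⟨by simpa using h3.trans_lt hsK.2, h0⟩
    have := hK (s • e) (hne s hs0) (hU (hgood _ (hne s hs0) (hnorm s hs0).le)).1
      (fun η h3 h4 => by
        rw [hnorm s hs0] at h3 h4
        exact (hU (hgood η (norm_pos_iff.1 (by linarith)) h4)).2)
    rw [hnorm s hs0] at this
    linarith
  · obtain ⟨⟨C₁, h1⟩, C₂, h2⟩ := H.infinity
    obtain ⟨K, hK⟩ := exists_rpow_le_of_conv_le (C₁ := C₁) (C₂ := C₂) H.omega_pos.le hB
    obtain ⟨ρ, -, hU⟩ := (Metric.hasBasis_cobounded_compl_closedBall (0 : Space n)).mem_iff.1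
      (by rw [Metric.cobounded_eq_cocompact]; exact h1.and h2)
    by_contra! hlt
    have ht : Tendsto (fun s : ℝ => s ^ ((n : ℝ) - θ - ω)) atTop atTop :=
      tendsto_rpow_atTop (by linarith)
    -- The factor $4$ keeps every $\eta$ with $|\eta|\ge s/4$ in the region where the asymptotics at
    -- infinity hold.
    obtain ⟨s, ⟨hs, hsρ⟩, hs0⟩ := (((ht.eventually_gt_atTop K).and
      (eventually_gt_atTop (4 * ρ))).and (eventually_gt_atTop 0)).exists
    have hgood : ∀ η : Space n, s / 4 ≤ ‖η‖ → η ∈ (Metric.closedBall (0 : Space n) ρ)ᶜ :=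
      fun η h3 => by simpa using by linarith
    have := hK (s • e) (hne s hs0) (hU (hgood _ (by rw [hnorm s hs0]; linarith))).1
      (fun η h3 h4 => by
        rw [hnorm s hs0] at h3 h4
        exact (hU (hgood η h3)).2)
    rw [hnorm s hs0] at this
    linarith

/-- A radial algebraic kernel with exponent `θ` is dominated by `|ξ|^{-(n-θ)}`. -/
theorem IsRadialAlgebraicKernel.le_rpow {n : ℕ} (hn : 1 ≤ n) {θ α ω : ℝ} (hθ : θ ≤ n)
    {h : Space n → ℝ≥0∞} (H : IsRadialAlgebraicKernel n θ α ω h) :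
    ∃ C : ℝ≥0, ∀ ξ : Space n, ξ ≠ 0 → h ξ ≤ C * ENNReal.ofReal (‖ξ‖ ^ (-((n : ℝ) - θ))) := by
  obtain ⟨hα, hω⟩ := H.exponents hn
  obtain ⟨⟨C₁, h1⟩, -⟩ := H.origin
  obtain ⟨⟨C₂, h2⟩, -⟩ := H.infinity
  obtain ⟨δ, hδ, hU⟩ := Metric.mem_nhdsWithin_iff.1 h1
  obtain ⟨ρ, -, hV⟩ := (Metric.hasBasis_cobounded_compl_closedBall (0 : Space n)).mem_iff.1
      (by rw [Metric.cobounded_eq_cocompact]; exact h2)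
  -- Capping the inner radius at $1$, and the outer one below by $1$, puts $|\xi|$ on the side of
  -- $1$ where $\alpha\le n-\theta\le\omega$ orders the powers correctly. On the shell between, $h$
  -- is bounded and $|\xi|^{-(n-\theta)}$ is bounded below.
  obtain ⟨C₃, h3⟩ := H.bounded (Metric.ball 0 (min δ 1)) (Metric.ball_mem_nhds _ (by positivity))
  have hρ : 0 < max ρ 1 := by positivity
  refine ⟨C₁ + C₂ + C₃ * (max ρ 1 ^ ((n : ℝ) - θ)).toNNReal, fun ξ hξ => ?_⟩
  have hξ0 : 0 < ‖ξ‖ := norm_pos_iff.2 hξ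
  push_cast
  rw [add_mul, add_mul]
  rcases lt_or_ge ‖ξ‖ (min δ 1) with hlt | hge
  · refine le_trans ((hU ⟨by simpa using hlt.trans_le (min_le_left _ _), hξ⟩).trans ?_)
      (le_self_add.trans le_self_add)
    refine mul_le_mul_right (ENNReal.ofReal_le_ofReal ?_) _
    exact Real.rpow_le_rpow_of_exponent_ge hξ0 (hlt.le.trans (min_le_right _ _)) (by linarith)
  rcases lt_or_ge (max ρ 1) ‖ξ‖ with hlt | hle
  · refine le_trans ((hV (by simpa using (le_max_left _ _).trans_lt hlt)).trans ?_)
      (le_add_self.trans le_self_add)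
    refine mul_le_mul_right (ENNReal.ofReal_le_ofReal ?_) _
    exact Real.rpow_le_rpow_of_exponent_le ((le_max_right _ _).trans hlt.le) (by linarith)
  · refine le_trans (h3 ξ (by rwa [mem_ball_zero_iff, not_lt])) (le_trans ?_ le_add_self)
    have : (1 : ℝ≥0∞) ≤ ((max ρ 1 ^ ((n : ℝ) - θ)).toNNReal : ℝ≥0∞) *
        ENNReal.ofReal (‖ξ‖ ^ (-((n : ℝ) - θ))) := by
      change 1 ≤ ENNReal.ofReal _ * _
      rw [← ENNReal.ofReal_mul (by positivity), ← ENNReal.ofReal_one]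
      apply ENNReal.ofReal_le_ofReal
      rw [Real.rpow_neg hξ0.le, ← div_eq_mul_inv, one_le_div (by positivity)]
      exact Real.rpow_le_rpow hξ0.le hle (by linarith)
    rw [mul_assoc]
    exact le_mul_of_one_le_right' this

/-- A majorization space whose kernel is dominated by `|ξ|^{-a}` embeds in `PM^a`. -/
theorem continuouslyEmbeds_majorization_pm {n m : ℕ} (hn : 1 ≤ n) {a : ℝ} {h : Space n → ℝ≥0∞}
    {C : ℝ≥0} (hpos : ∀ ξ, 0 < h ξ)
    (hC : ∀ ξ : Space n, ξ ≠ 0 → h ξ ≤ C * ENNReal.ofReal (‖ξ‖ ^ (-a))) :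
    ContinuouslyEmbeds (n := n) (m := m) (majorizationNorm h) (pmNorm a) := by
  have : NeZero n := ⟨by omega⟩
  have hae : ∀ᵐ ξ : Space n, ξ ≠ 0 := by simp [ae_iff, measure_singleton]
  have key : ∀ f : 𝓢'(Space n, Vec m), pmNorm a f ≤ C * majorizationNorm h f := by
    intro f
    -- Needed to move $C$ inside an infimum that may be $\infty$. Both norms are infima over the
    -- same representatives, so they are then compared one `g` at a time.
    have hC0 : (C : ℝ≥0∞) ≠ 0 := by
      rintro h0
      have h1 := (hpos (EuclideanSpace.single 0 1)).trans_le (hC (EuclideanSpace.single 0 1) (by simp))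
      simp [h0] at h1
    unfold majorizationNorm pmNorm
    simp_rw [ENNReal.mul_iInf_of_ne hC0 ENNReal.coe_ne_top]
    refine iInf₂_mono fun g hg => ?_
    rw [← ENNReal.essSup_const_mul]
    refine essSup_mono_ae ?_
    filter_upwards [hae] with ξ hξ
    have hξ0 : 0 < ‖ξ‖ := norm_pos_iff.2 hξ
    rw [← mul_assoc]
    gcongr
    have hh := hC ξ hξ
    rw [← div_eq_mul_inv, ENNReal.le_div_iff_mul_le (.inl (hpos ξ).ne')
      (.inl (ne_top_of_le_ne_top (by finiteness) hh))]
    calc ENNReal.ofReal (‖ξ‖ ^ a) * h ξ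
        ≤ ENNReal.ofReal (‖ξ‖ ^ a) * (C * ENNReal.ofReal (‖ξ‖ ^ (-a))) := by gcongr
      _ = C * ENNReal.ofReal (‖ξ‖ ^ a * ‖ξ‖ ^ (-a)) := by
        rw [ENNReal.ofReal_mul (by positivity)]; ring
      _ = C := by rw [← Real.rpow_add hξ0]; simp
  exact ⟨fun f hf => (key f).trans_lt (ENNReal.mul_lt_top ENNReal.coe_lt_top hf),
    C, fun f _ => key f⟩

/-! ### Extending the pairing from compactly supported to Schwartz test functions -/

open scoped ContDiff in
/-- Dilating a compactly supported smooth function outwards keeps its derivatives bounded. -/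
theorem exists_bound_iteratedFDeriv_dilate {E F : Type*} [NormedAddCommGroup E] [NormedSpace ℝ E]
    [NormedAddCommGroup F] [NormedSpace ℝ F] {χ : E → F} (h₁ : HasCompactSupport χ)
    (h₂ : ContDiff ℝ ∞ χ) (i : ℕ) :
    ∃ C : ℝ, ∀ s : ℝ, |s| ≤ 1 → ∀ x, ‖iteratedFDeriv ℝ i (fun x => χ (s • x)) x‖ ≤ C := by
  obtain ⟨C, hC⟩ := (h₁.iteratedFDeriv (𝕜 := ℝ) i).exists_bound_of_continuous
    (h₂.continuous_iteratedFDeriv (by exact_mod_cast le_top))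
  refine ⟨C, fun s hs x => ?_⟩
  -- By the chain rule each derivative costs a factor of norm at most $|s|\le1$.
  have := ContinuousLinearMap.iteratedFDeriv_comp_right (s • ContinuousLinearMap.id ℝ E) h₂ x
    (i := i) (by exact_mod_cast le_top)
  have e : (χ ∘ (s • ContinuousLinearMap.id ℝ E : E →L[ℝ] E)) = fun x => χ (s • x) := by
    ext; simp
  rw [e] at this
  rw [this]
  refine (ContinuousMultilinearMap.norm_compContinuousLinearMap_le _ _).trans ?_
  refine (mul_le_of_le_one_right (norm_nonneg _) ?_).trans (hC _)
  refine Finset.prod_le_one (fun _ _ => norm_nonneg _) fun _ _ => ?_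
  refine (norm_smul_le _ _).trans ?_
  exact mul_le_one₀ hs (norm_nonneg _) ContinuousLinearMap.norm_id_le

open scoped ContDiff in
/-- Compactly supported functions are dense in the Schwartz space, with domination. -/
theorem exists_tendsto_hasCompactSupport {n : ℕ} (φ : 𝓢(Space n, ℂ)) :
    ∃ u : ℕ → 𝓢(Space n, ℂ), (∀ N, HasCompactSupport (u N)) ∧ Tendsto u atTop (𝓝 φ) ∧
      ∀ N x, ‖u N x‖ ≤ ‖φ x‖ := by
  let b : ContDiffBump (0 : Space n) := ⟨1, 2, one_pos, one_lt_two⟩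
  let χ : ℕ → Space n → ℝ := fun N x => b (((N : ℝ) + 1)⁻¹ • x)
  have hN : ∀ N : ℕ, (0 : ℝ) < (N : ℝ) + 1 := fun N => by positivity
  have hsmooth : ∀ N, ContDiff ℝ ∞ (χ N) := fun N =>
    b.contDiff.comp (contDiff_const_smul _)
  have hsupp : ∀ N, HasCompactSupport (χ N) := fun N =>
    b.hasCompactSupport.comp_homeomorph (Homeomorph.smulOfNeZero _ (inv_pos.2 (hN N)).ne')
  have htg : ∀ N, (χ N).HasTemperateGrowth := fun N => (hsupp N).hasTemperateGrowth (hsmooth N)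
  let w : ℕ → Space n → ℝ := fun N x => χ N x - 1
  have hwtg : ∀ N, (w N).HasTemperateGrowth := fun N => (htg N).sub (.const 1)
  let u : ℕ → 𝓢(Space n, ℂ) := fun N => SchwartzMap.smulLeftCLM ℂ (χ N) φ
  have hu : ∀ N x, u N x = χ N x • φ x := fun N x =>
    SchwartzMap.smulLeftCLM_apply_apply (htg N) φ x
  refine ⟨u, fun N => ?_, ?_, fun N x => ?_⟩
  · have : (u N : Space n → ℂ) = fun x => χ N x • φ x := funext (hu N)
    rw [this]
    exact (hsupp N).smul_right
  · rw [(schwartz_withSeminorms ℝ (Space n) ℂ).tendsto_nhds_atTop u φ]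
    rintro ⟨k, l⟩ ε hε
    choose D hD using fun i => exists_bound_iteratedFDeriv_dilate b.hasCompactSupport
      b.contDiff i
    set M : ℝ := ∑ i ∈ Finset.range (l + 1), (l.choose i : ℝ) * (|D i| + 1) *
      SchwartzMap.seminorm ℝ (k + 1) (l - i) φ with hM
    have hM0 : 0 ≤ M := Finset.sum_nonneg fun i _ => by positivity
    have hwD : ∀ N i x, ‖iteratedFDeriv ℝ i (w N) x‖ ≤ |D i| + 1 := by
      intro N i x
      have hs : |((N : ℝ) + 1)⁻¹| ≤ 1 := by
        rw [abs_of_pos (inv_pos.2 (hN N))]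
        exact inv_le_one_of_one_le₀ (by simp)
      have h1 := hD i _ hs x
      have h2 : iteratedFDeriv ℝ i (w N) x = iteratedFDeriv ℝ i (χ N) x -
          iteratedFDeriv ℝ i (fun _ => (1 : ℝ)) x :=
        iteratedFDeriv_sub_apply ((hsmooth N).contDiffAt.of_le (by exact_mod_cast le_top))
          contDiffAt_const
      have h3 : ‖iteratedFDeriv ℝ i (fun _ : Space n => (1 : ℝ)) x‖ ≤ 1 := by
        rcases i with _ | i
        · simp
        · rw [iteratedFDeriv_succ_const]; simp
      rw [h2]
      refine (norm_sub_le _ _).trans (add_le_add (h1.trans (le_abs_self _)) h3)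
    -- The cutoff error `w N` vanishes on $|x|<N+1$; outside, trading one extra power of $|x|$ in
    -- the seminorm gains $1/(N+1)$.
    have hbd : ∀ N, SchwartzMap.seminorm ℝ k l (u N - φ) ≤ M / (N + 1) := by
      intro N
      refine SchwartzMap.seminorm_le_bound ℝ k l _ (by positivity) fun x => ?_
      have hfun : ((u N - φ : 𝓢(Space n, ℂ)) : Space n → ℂ) = fun x => w N x • φ x := by
        ext y
        simp only [w, sub_smul, one_smul]
        rw [← hu]; rfl
      rw [hfun]
      rcases lt_or_ge ‖x‖ ((N : ℝ) + 1) with hlt | hge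
      · have h0 : (fun x => w N x • φ x) =ᶠ[𝓝 x] fun _ => (0 : ℂ) := by
          filter_upwards [Metric.isOpen_ball.mem_nhds (show x ∈ Metric.ball 0 ((N : ℝ) + 1) by
            simpa using hlt)] with y hy
          have : χ N y = 1 := b.one_of_mem_closedBall (by
            have hy' : ‖y‖ < N + 1 := by simpa using hy
            rw [mem_closedBall_zero_iff, norm_smul, norm_inv, Real.norm_of_nonneg (hN N).le]
            change _ ≤ (1 : ℝ)
            rw [inv_mul_le_iff₀ (hN N)]; linarith)
          simp [w, this]
        rw [(h0.iteratedFDeriv ℝ l).eq_of_nhds]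
        have : iteratedFDeriv ℝ l (fun _ : Space n => (0 : ℂ)) x = 0 := by simp
        rw [this]; simp; positivity
      · have h1 := norm_iteratedFDeriv_smul_le (𝕜 := ℝ) (hwtg N).1 (φ.smooth ⊤) x (n := l)
          (by exact_mod_cast le_top)
        have h2 : ‖x‖ ^ k ≤ ‖x‖ ^ (k + 1) / (N + 1) := by
          rw [le_div_iff₀ (hN N), pow_succ]
          gcongr
        calc ‖x‖ ^ k * ‖iteratedFDeriv ℝ l (fun x => w N x • φ x) x‖
            ≤ ‖x‖ ^ (k + 1) / (N + 1) * ∑ i ∈ Finset.range (l + 1), (l.choose i : ℝ) *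
              ‖iteratedFDeriv ℝ i (w N) x‖ * ‖iteratedFDeriv ℝ (l - i) φ x‖ := by gcongr
          _ = (∑ i ∈ Finset.range (l + 1), (l.choose i : ℝ) *
              ‖iteratedFDeriv ℝ i (w N) x‖ *
                (‖x‖ ^ (k + 1) * ‖iteratedFDeriv ℝ (l - i) φ x‖)) / (N + 1) := by
            rw [div_mul_eq_mul_div, Finset.mul_sum]
            congr 1
            exact Finset.sum_congr rfl fun i _ => by ring
          _ ≤ M / (N + 1) := by
            refine div_le_div_of_nonneg_right (Finset.sum_le_sum fun i _ => ?_) (hN N).le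
            gcongr
            · exact hwD N i x
            · exact φ.le_seminorm ℝ (k + 1) (l - i) x
    have hlim : Tendsto (fun N : ℕ => M / ((N : ℝ) + 1)) atTop (𝓝 0) := by
      simpa [div_eq_mul_one_div M] using (tendsto_one_div_add_atTop_nhds_zero_nat (𝕜 := ℝ)).const_mul M
    obtain ⟨N₀, h0⟩ := eventually_atTop.1 (hlim.eventually_lt_const hε)
    exact ⟨N₀, fun N hN' => (hbd N).trans_lt (h0 N hN')⟩
  · rw [hu, norm_smul, Real.norm_of_nonneg b.nonneg]
    exact mul_le_of_le_one_left (norm_nonneg _) b.le_one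

/-- If a tempered distribution is a function, its pairing with a Schwartz function is given by the
integral as soon as the latter converges absolutely. -/
theorem IsFunction.apply_eq_integral {n : ℕ} {F : Type*} [NormedAddCommGroup F] [NormedSpace ℂ F]
    {T : 𝓢'(Space n, F)} {g : Space n → F} (hT : IsFunction T g) (φ : 𝓢(Space n, ℂ))
    (hint : Integrable fun ξ => φ ξ • g ξ) : T φ = ∫ ξ, φ ξ • g ξ := by
  obtain ⟨u, hc, hlim, hle⟩ := exists_tendsto_hasCompactSupport φ
  -- The truncations converge in the Schwartz topology, which handles $T$, and are dominated by
  -- $|\varphi|$, which handles the integral; the two limits must agree.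
  have h1 : Tendsto (fun N => T (u N)) atTop (𝓝 (T φ)) :=
    ((map_continuous T).tendsto φ).comp hlim
  have hpt : ∀ x, Tendsto (fun N => u N x) atTop (𝓝 (φ x)) := fun x => by
    have h := ((SchwartzMap.toBoundedContinuousFunctionCLM ℝ (Space n) ℂ).continuous.tendsto φ).comp
      hlim
    exact ((BoundedContinuousFunction.lipschitz_eval_const x).continuous.tendsto _).comp h
  have h2 : Tendsto (fun N => T (u N)) atTop (𝓝 (∫ ξ, φ ξ • g ξ)) := by
    simp_rw [fun N => hT.2 (u N) (hc N)]
    refine tendsto_integral_of_dominated_convergence (fun ξ => ‖φ ξ • g ξ‖) (fun N => ?_)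
      hint.norm (fun N => ?_) ?_
    · exact (u N).continuous.aestronglyMeasurable.smul hT.1.aestronglyMeasurable
    · filter_upwards with ξ
      rw [norm_smul, norm_smul]
      gcongr
      exact hle N ξ
    · filter_upwards with ξ
      exact (hpt ξ).smul_const _
  exact tendsto_nhds_unique h1 h2

/-! ### Plancherel's theorem for Fourier integrals -/

open scoped ContDiff in
/-- Plancherel's theorem for the Fourier integral of a function in `L¹ ∩ L²`. -/
theorem eLpNorm_fourier_eq {E F : Type*} [NormedAddCommGroup E] [InnerProductSpace ℝ E]
    [FiniteDimensional ℝ E] [MeasurableSpace E] [BorelSpace E] [NormedAddCommGroup F]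
    [InnerProductSpace ℂ F] [CompleteSpace F] {G : E → F}
    (h1 : Integrable G) (h2 : MemLp G 2) : eLpNorm (𝓕 G) 2 volume = eLpNorm G 2 volume := by
  obtain ⟨U, hU⟩ : ∃ U : Lp F 2 (volume : Measure E), U = 𝓕 (h2.toLp G) := ⟨_, rfl⟩
  have hcont : Continuous (𝓕 G) :=
    VectorFourier.fourierIntegral_continuous Real.continuous_fourierChar (by
      exact continuous_inner) h1
  -- The abstract $L^2$ transform already is an isometry, so it only has to be identified with the
  -- integral. Both give the same result against smooth compactly supported functions: move the
  -- transform onto the test function for one, and back by Fubini for the other.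
  have hae : ∀ᵐ x, U x = 𝓕 G x := by
    refine ae_eq_of_integral_contDiff_smul_eq ((Lp.memLp U).locallyIntegrable (by norm_num))
      hcont.locallyIntegrable fun g hg hgc => ?_
    have hg₁ : HasCompactSupport (Complex.ofRealCLM ∘ g) := hgc.comp_left rfl
    have hg₂ : ContDiff ℝ ∞ (Complex.ofRealCLM ∘ g) := by fun_prop
    set φ : 𝓢(E, ℂ) := hg₁.toSchwartzMap hg₂ with hφ
    have hφx : ∀ x, φ x = (g x : ℂ) := fun x => rfl
    have e1 : ∫ x, g x • U x = (U : 𝓢'(E, F)) φ := by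
      rw [Lp.toTemperedDistribution_apply]
      simp_rw [hφx]
      rfl
    have e2 : (U : 𝓢'(E, F)) φ = ∫ x, (𝓕 φ) x • G x := by
      rw [hU, ← Lp.fourier_toTemperedDistribution_eq, TemperedDistribution.fourier_apply,
        Lp.toTemperedDistribution_apply]
      refine integral_congr_ae ?_
      filter_upwards [h2.coeFn_toLp] with x hx
      rw [hx]
    have e3 : ∫ x, (𝓕 φ) x • G x = ∫ x, φ x • 𝓕 G x := by
      have := VectorFourier.integral_fourierIntegral_smul_eq_flip (L := innerₗ E)
        (μ := (volume : Measure E)) (ν := volume) (f := φ) (g := G)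
        Real.continuous_fourierChar continuous_inner φ.integrable h1
      rw [flip_innerₗ] at this
      exact this
    rw [e1, e2, e3]
    rfl
  have hnorm : ‖U‖ₑ = ‖h2.toLp G‖ₑ := by
    rw [← ofReal_norm, ← ofReal_norm, hU, Lp.norm_fourier_eq]
  rw [eLpNorm_congr_ae (show 𝓕 G =ᵐ[volume] U from hae.mono fun x hx => hx.symm), ← Lp.enorm_def,
    hnorm, Lp.enorm_toLp]

/-! ### Integrals of powers of the norm -/

/-- Scaling of the Lebesgue integral on `ℝⁿ`. -/
theorem lintegral_eq_mul_lintegral_comp_smul {n : ℕ} (f : Space n → ℝ≥0∞) {r : ℝ} (hr : 0 < r) :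
    ∫⁻ x, f x = ENNReal.ofReal (r ^ n) * ∫⁻ x, f (r • x) := by
  have h1 : ∫⁻ x, f (r • x) = ∫⁻ x, f x ∂(Measure.map (r • ·) volume) :=
    ((Homeomorph.smulOfNeZero r hr.ne').measurableEmbedding.lintegral_map f).symm
  rw [h1, Measure.map_addHaar_smul _ hr.ne', lintegral_smul_measure, smul_eq_mul, ← mul_assoc,
    ← ENNReal.ofReal_mul (by positivity), finrank_euclideanSpace_fin, abs_of_pos (by positivity),
    mul_inv_cancel₀ (by positivity), ENNReal.ofReal_one, one_mul]

/-- A set integral of a power of the norm scales like the corresponding power. -/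
theorem setLIntegral_norm_rpow_scale {n : ℕ} {b r : ℝ} (hr : 0 < r) {S₁ S : Set (Space n)}
    (h₁ : MeasurableSet S₁) (h : MeasurableSet S) (hS : ∀ x, r • x ∈ S ↔ x ∈ S₁) :
    ∫⁻ ξ in S, ENNReal.ofReal (‖ξ‖ ^ (-b)) =
      (∫⁻ ξ in S₁, ENNReal.ofReal (‖ξ‖ ^ (-b))) * ENNReal.ofReal (r ^ ((n : ℝ) - b)) := by
  rw [← lintegral_indicator h, ← lintegral_indicator h₁,
    lintegral_eq_mul_lintegral_comp_smul _ hr]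
  have : ∀ x : Space n, S.indicator (fun ξ => ENNReal.ofReal (‖ξ‖ ^ (-b))) (r • x) =
      ENNReal.ofReal (r ^ (-b)) * S₁.indicator (fun ξ => ENNReal.ofReal (‖ξ‖ ^ (-b))) x := by
    intro x
    by_cases hx : x ∈ S₁
    · rw [Set.indicator_of_mem hx, Set.indicator_of_mem ((hS x).2 hx), norm_smul,
        Real.norm_of_nonneg hr.le, Real.mul_rpow hr.le (norm_nonneg _),
        ENNReal.ofReal_mul (by positivity)]
    · rw [Set.indicator_of_notMem hx, Set.indicator_of_notMem (mt (hS x).1 hx), mul_zero]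
  simp_rw [this]
  rw [lintegral_const_mul' _ _ ENNReal.ofReal_ne_top, ← mul_assoc,
    ← ENNReal.ofReal_mul (by positivity), mul_comm, ← Real.rpow_natCast, ← Real.rpow_add hr,
    sub_eq_add_neg]

/-- Polar coordinates reduce finiteness at $r=1$ to integrability of $y^{n-1-b}$ near $0$; scaling
gives the other radii. This serves the low frequencies. -/
theorem exists_setLIntegral_ball_norm_rpow {n : ℕ} (hn : 1 ≤ n) {b : ℝ} (hb : b < n) :
    ∃ A : ℝ≥0, ∀ r : ℝ, 0 < r →
      ∫⁻ ξ in Metric.ball (0 : Space n) r, ENNReal.ofReal (‖ξ‖ ^ (-b)) =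
        A * ENNReal.ofReal (r ^ ((n : ℝ) - b)) := by
  have : NeZero n := ⟨by omega⟩
  have hint : IntegrableOn (fun ξ : Space n => ‖ξ‖ ^ (-b)) (Metric.ball 0 1) := by
    rw [integrableOn_fun_norm_addHaar volume (f := fun y => y ^ (-b)), finrank_euclideanSpace_fin]
    have h1 : IntegrableOn (fun y : ℝ => y ^ ((n : ℝ) - 1 - b)) (Set.Ioo 0 1) :=
      (intervalIntegral.integrableOn_Ioo_rpow_iff one_pos).2 (by linarith)
    refine h1.congr_fun (fun y hy => ?_) measurableSet_Ioo
    simp only [smul_eq_mul]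
    rw [← Real.rpow_natCast, ← Real.rpow_add hy.1, Nat.cast_sub hn, Nat.cast_one, sub_eq_add_neg _ b]
  have hfin : ∫⁻ ξ in Metric.ball (0 : Space n) 1, ENNReal.ofReal (‖ξ‖ ^ (-b)) ≠ ∞ :=
    hint.lintegral_lt_top.ne
  refine ⟨(∫⁻ ξ in Metric.ball (0 : Space n) 1, ENNReal.ofReal (‖ξ‖ ^ (-b))).toNNReal,
    fun r hr => ?_⟩
  rw [ENNReal.coe_toNNReal hfin]
  refine setLIntegral_norm_rpow_scale hr measurableSet_ball measurableSet_ball fun x => ?_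
  rw [mem_ball_zero_iff, mem_ball_zero_iff, norm_smul, Real.norm_of_nonneg hr.le,
    mul_lt_iff_lt_one_right hr]

/-- The counterpart at infinity, where integrability of $y^{n-1-b}$ requires $b>n$. This serves the
high frequencies. -/
theorem exists_setLIntegral_compl_ball_norm_rpow {n : ℕ} (hn : 1 ≤ n) {b : ℝ} (hb : n < b) :
    ∃ A : ℝ≥0, ∀ r : ℝ, 0 < r →
      ∫⁻ ξ in (Metric.ball (0 : Space n) r)ᶜ, ENNReal.ofReal (‖ξ‖ ^ (-b)) =
        A * ENNReal.ofReal (r ^ ((n : ℝ) - b)) := by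
  have : NeZero n := ⟨by omega⟩
  have hint : IntegrableOn (fun ξ : Space n => ‖ξ‖ ^ (-b)) (Metric.ball 0 1)ᶜ := by
    have h0 : Integrable (fun ξ : Space n => (Set.Ici 1).indicator (fun y : ℝ => y ^ (-b)) ‖ξ‖) := by
      rw [integrable_fun_norm_addHaar volume (f := (Set.Ici 1).indicator (fun y : ℝ => y ^ (-b))),
        finrank_euclideanSpace_fin]
      have h1 : IntegrableOn (fun y : ℝ => y ^ ((n : ℝ) - 1 - b)) (Set.Ici 1) :=
        (integrableOn_Ici_iff_integrableOn_Ioi (by simp)).2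
          ((integrableOn_Ioi_rpow_iff one_pos).2 (by linarith))
      rw [← integrable_indicator_iff measurableSet_Ici] at h1
      refine h1.integrableOn.congr_fun (fun y hy => ?_) measurableSet_Ioi
      by_cases h2 : y ∈ Set.Ici (1 : ℝ)
      · simp only [Set.indicator_of_mem h2, smul_eq_mul]
        rw [← Real.rpow_natCast, ← Real.rpow_add hy, Nat.cast_sub hn, Nat.cast_one,
          sub_eq_add_neg _ b]
      · simp [Set.indicator_of_notMem h2]
    rw [← integrable_indicator_iff measurableSet_ball.compl]
    refine h0.congr (.of_forall fun ξ => ?_)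
    beta_reduce
    by_cases h2 : 1 ≤ ‖ξ‖
    · rw [Set.indicator_of_mem (show ‖ξ‖ ∈ Set.Ici (1 : ℝ) from h2), Set.indicator_of_mem (by simpa)]
    · rw [Set.indicator_of_notMem (show ‖ξ‖ ∉ Set.Ici (1 : ℝ) from h2),
        Set.indicator_of_notMem (by simpa using h2)]
  have hfin : ∫⁻ ξ in (Metric.ball (0 : Space n) 1)ᶜ, ENNReal.ofReal (‖ξ‖ ^ (-b)) ≠ ∞ :=
    hint.lintegral_lt_top.ne
  refine ⟨(∫⁻ ξ in (Metric.ball (0 : Space n) 1)ᶜ, ENNReal.ofReal (‖ξ‖ ^ (-b))).toNNReal,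
    fun r hr => ?_⟩
  rw [ENNReal.coe_toNNReal hfin]
  refine setLIntegral_norm_rpow_scale hr measurableSet_ball.compl measurableSet_ball.compl
    fun x => ?_
  rw [Set.mem_compl_iff, Set.mem_compl_iff, mem_ball_zero_iff, mem_ball_zero_iff, norm_smul,
    Real.norm_of_nonneg hr.le, mul_lt_iff_lt_one_right hr]

/-! ### The heat kernel as a Fourier transform -/

/-- The heat kernel centred at `y` is the Fourier transform of a modulated Gaussian. -/
theorem exists_schwartzFourier_eq_heatKernel (n : ℕ) {t : ℝ} (ht : 0 < t) (y : Space n) :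
    ∃ ψ : 𝓢(Space n, ℂ), schwartzFourier n ψ = heatKernel n t y ∧
      ∀ ξ, ψ ξ = (((2 * Real.pi) ^ (-(n : ℝ) / 2) : ℝ) : ℂ) *
        Complex.exp (-t * ‖ξ‖ ^ 2 + Complex.I * (inner ℝ y ξ : ℝ)) := by
  set c : ℂ := (((2 * Real.pi) ^ (-(n : ℝ) / 2) : ℝ) : ℂ) with hc
  have hpi : 0 < 2 * Real.pi := by positivity
  have hc0 : c ≠ 0 := by
    rw [hc]; exact_mod_cast (Real.rpow_pos_of_pos hpi _).ne'
  set K : 𝓢(Space n, ℂ) :=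
    SchwartzMap.compCLMOfContinuousLinearEquiv ℂ (dilation n).symm (heatKernel n t y) with hK
  set φ₀ : Space n → ℂ := fun ξ => Complex.exp (-t * ‖ξ‖ ^ 2 + Complex.I * (inner ℝ y ξ : ℝ))
    with hφ₀
  have hcont : Continuous φ₀ := by fun_prop
  have htre : 0 < (t : ℂ).re := by simpa using ht
  have hint : Integrable φ₀ := GaussianFourier.integrable_cexp_neg_mul_sq_norm_add htre _ y
  have hdil : ∀ w : Space n, (dilation n).symm w = (2 * Real.pi) • w := fun w => by
    rw [ContinuousLinearEquiv.symm_apply_eq]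
    change w = (2 * Real.pi)⁻¹ • (2 * Real.pi) • w
    rw [inv_smul_smul₀ hpi.ne']
  -- The Gaussian transform formula with frequency $y/(2\pi)$, matched to the heat kernel at $2\pi
  -- w$; the factor $c^{-2}=(2\pi)^n$ reconciles the normalizations.
  have hF : 𝓕 φ₀ = (c⁻¹ * c⁻¹) • (K : Space n → ℂ) := by
    ext w
    have h1 : φ₀ = fun v => Complex.exp (-t * ‖v‖ ^ 2 + 2 * Real.pi * Complex.I *
        (inner ℝ ((2 * Real.pi)⁻¹ • y) v : ℝ)) := by
      ext v
      rw [hφ₀, inner_smul_left]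
      simp only [conj_trivial]
      congr 2
      push_cast
      have : (Real.pi : ℂ) ≠ 0 := by exact_mod_cast Real.pi_ne_zero
      field_simp
    rw [h1, fourier_gaussian_innerProductSpace' htre]
    have h2 : K w = heatKernel n t y ((2 * Real.pi) • w) := by
      rw [← hdil]; rfl
    rw [Pi.smul_apply, h2, heatKernel_apply n t ht, smul_eq_mul, finrank_euclideanSpace_fin]
    have h3 : ‖(2 * Real.pi) • w - y‖ ^ 2 = (2 * Real.pi) ^ 2 * ‖(2 * Real.pi)⁻¹ • y - w‖ ^ 2 := by
      have : (2 * Real.pi) • w - y = -((2 * Real.pi) • ((2 * Real.pi)⁻¹ • y - w)) := by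
        rw [smul_sub, smul_inv_smul₀ hpi.ne']; abel
      rw [this, norm_neg, norm_smul, mul_pow, Real.norm_of_nonneg hpi.le]
    rw [h3]
    have h4 : ((Real.pi : ℂ) / t) ^ ((n : ℂ) / 2) =
        ((c⁻¹ * c⁻¹) * (((4 * Real.pi * t) ^ (-(n : ℝ) / 2) : ℝ) : ℂ)) := by
      rw [hc, ← Complex.ofReal_div, show ((n : ℂ) / 2) = (((n : ℝ) / 2 : ℝ) : ℂ) by push_cast; rfl,
        ← Complex.ofReal_cpow (by positivity), ← Complex.ofReal_inv, ← Complex.ofReal_mul,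
        ← Complex.ofReal_mul]
      congr 1
      rw [neg_div, Real.rpow_neg hpi.le, inv_inv, Real.rpow_neg (by positivity),
        ← Real.mul_rpow hpi.le hpi.le, ← div_eq_mul_inv, ← Real.div_rpow (by positivity)
        (by positivity)]
      congr 1
      field_simp
      norm_num
    rw [h4, mul_assoc, Complex.ofReal_mul, Complex.ofReal_exp]
    congr 3
    push_cast
    field_simp
    ring
  -- Defining $\psi$ by inversion makes it Schwartz for free and its transform immediate; its values
  -- then follow from `hF` and Fourier inversion.
  refine ⟨c⁻¹ • 𝓕⁻ K, ?_, fun ξ => ?_⟩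
  · have h1 : schwartzFourier n (c⁻¹ • 𝓕⁻ K) = c • (SchwartzMap.compCLMOfContinuousLinearEquiv ℂ
        (dilation n)) (𝓕 (c⁻¹ • 𝓕⁻ K)) := rfl
    rw [h1, FourierTransform.fourier_smul, FourierTransform.fourier_fourierInv_eq, map_smul,
      smul_smul, mul_inv_cancel₀ hc0, one_smul]
    ext x
    change heatKernel n t y ((dilation n).symm (dilation n x)) = _
    rw [ContinuousLinearEquiv.symm_apply_apply]
  · have hKint : Integrable (𝓕 φ₀) := by rw [hF]; exact K.integrable.smul _
    have h1 : ((c * c) • 𝓕 φ₀ : Space n → ℂ) = K := by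
      rw [hF, smul_smul]
      have : c * c * (c⁻¹ * c⁻¹) = 1 := by field_simp
      rw [this, one_smul]
    have h2 : (𝓕⁻ K : 𝓢(Space n, ℂ)) ξ = c * c * φ₀ ξ := by
      rw [SchwartzMap.fourierInv_coe, ← h1]
      rw [Real.fourierInv_eq]
      simp only [Pi.smul_apply]
      simp_rw [smul_comm _ (c * c)]
      rw [integral_smul, ← Real.fourierInv_eq, hcont.fourierInv_fourier_eq hint hKint, smul_eq_mul]
    change c⁻¹ * (𝓕⁻ K : 𝓢(Space n, ℂ)) ξ = _
    rw [h2]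
    change _ = c * φ₀ ξ
    field_simp

/-- The modulated Gaussian `e^{-t|ξ|² + i y·ξ}`. -/
def heatSymbol {n : ℕ} (t : ℝ) (y ξ : Space n) : ℂ :=
  Complex.exp (-t * ‖ξ‖ ^ 2 + Complex.I * (inner ℝ y ξ : ℝ))

theorem heatSymbol_eq_mul {n : ℕ} (t : ℝ) (y ξ : Space n) :
    heatSymbol t y ξ =
      Complex.exp (Complex.I * (inner ℝ y ξ : ℝ)) * (Real.exp (-(t * ‖ξ‖ ^ 2)) : ℝ) := by
  rw [heatSymbol, Complex.ofReal_exp, ← Complex.exp_add]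
  congr 1
  push_cast
  ring

theorem norm_heatSymbol {n : ℕ} (t : ℝ) (y ξ : Space n) :
    ‖heatSymbol t y ξ‖ = Real.exp (-(t * ‖ξ‖ ^ 2)) := by
  rw [heatSymbol_eq_mul, norm_mul, mul_comm Complex.I, Complex.norm_exp_ofReal_mul_I, one_mul,
    Complex.norm_real, Real.norm_of_nonneg (Real.exp_pos _).le]

theorem continuous_heatSymbol {n : ℕ} (t : ℝ) (y : Space n) : Continuous (heatSymbol t y) := by
  unfold heatSymbol
  fun_prop

/-- A function bounded by `M |ξ|^{-a}` is bounded off balls around the origin. -/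
theorem ae_norm_le_of_notMem_ball {n m : ℕ} {g : Space n → Vec m} {a : ℝ} (ha : 0 ≤ a) {M : ℝ≥0}
    (hg : ∀ᵐ ξ, ‖g ξ‖ₑ ≤ M * ENNReal.ofReal (‖ξ‖ ^ (-a))) {r : ℝ} (hr : 0 < r) :
    ∀ᵐ ξ, ξ ∉ Metric.ball 0 r → ‖g ξ‖ ≤ M * r ^ (-a) := by
  filter_upwards [hg] with ξ h hξ
  rw [mem_ball_zero_iff, not_lt] at hξ
  have h1 : ‖g ξ‖ ≤ M * ‖ξ‖ ^ (-a) := by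
    have := ENNReal.toReal_mono (by finiteness) h
    rwa [ENNReal.toReal_mul, ENNReal.toReal_ofReal (by positivity), toReal_enorm] at this
  exact h1.trans (mul_le_mul_of_nonneg_left
    (Real.rpow_le_rpow_of_nonpos hr hξ (by linarith)) M.2)

/-- Near the origin local integrability of `g` suffices, so no upper bound on `a` is needed; away
from it `g` is bounded and the Gaussian decays. -/
theorem integrable_heatSymbol_smul {n m : ℕ} {g : Space n → Vec m} (hloc : LocallyIntegrable g)
    {a : ℝ} (ha : 0 ≤ a) {M : ℝ≥0} (hg : ∀ᵐ ξ, ‖g ξ‖ₑ ≤ M * ENNReal.ofReal (‖ξ‖ ^ (-a)))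
    {t : ℝ} (ht : 0 < t) (y : Space n) : Integrable fun ξ => heatSymbol t y ξ • g ξ := by
  have h1 : IntegrableOn g (Metric.ball 0 1) :=
    (hloc.integrableOn_isCompact (isCompact_closedBall 0 1)).mono_set Metric.ball_subset_closedBall
  rw [← integrable_indicator_iff measurableSet_ball] at h1
  refine (h1.norm.add ((gaussian n t ht).integrable.const_mul (M * 1 ^ (-a)))).mono'
    ((continuous_heatSymbol t y).aestronglyMeasurable.smul hloc.aestronglyMeasurable) ?_
  filter_upwards [ae_norm_le_of_notMem_ball ha hg one_pos] with ξ hξ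
  have hgauss : gaussian n t ht ξ = Real.exp (-(t * ‖ξ‖ ^ 2)) := rfl
  have hexp : Real.exp (-(t * ‖ξ‖ ^ 2)) ≤ 1 := Real.exp_le_one_iff.2 (by
    have : 0 ≤ t * ‖ξ‖ ^ 2 := by positivity
    linarith)
  simp only [Pi.add_apply]
  rw [norm_smul, norm_heatSymbol, hgauss]
  by_cases h2 : ξ ∈ Metric.ball (0 : Space n) 1
  · rw [Set.indicator_of_mem h2]
    exact (mul_le_of_le_one_left (norm_nonneg _) hexp).trans (le_add_of_nonneg_right (by positivity))
  · rw [Set.indicator_of_notMem h2, norm_zero, zero_add, mul_comm]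
    gcongr
    exact hξ h2

/-- The caloric extension in terms of the Fourier transform. -/
theorem heat_eq_integral {n m : ℕ} {f : 𝓢'(Space n, Vec m)} {g : Space n → Vec m}
    (hf : IsFunction (fourierDist f) g) {a : ℝ} (ha : 0 ≤ a) {M : ℝ≥0}
    (hg : ∀ᵐ ξ, ‖g ξ‖ₑ ≤ M * ENNReal.ofReal (‖ξ‖ ^ (-a))) {t : ℝ} (ht : 0 < t) (y : Space n) :
    heat f t y = (((2 * Real.pi) ^ (-(n : ℝ) / 2) : ℝ) : ℂ) • ∫ ξ, heatSymbol t y ξ • g ξ := by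
  obtain ⟨ψ, hψ, hval⟩ := exists_schwartzFourier_eq_heatKernel n ht y
  have h1 : heat f t y = fourierDist f ψ := by
    rw [heat, ← hψ]; rfl
  have h2 : (fun ξ => ψ ξ • g ξ) = fun ξ =>
      (((2 * Real.pi) ^ (-(n : ℝ) / 2) : ℝ) : ℂ) • (heatSymbol t y ξ • g ξ) := by
    ext1 ξ
    rw [hval, ← smul_smul]
    rfl
  rw [h1, hf.apply_eq_integral ψ (by
    rw [h2]; exact (integrable_heatSymbol_smul hf.1 ha hg ht y).smul
      (((2 * Real.pi) ^ (-(n : ℝ) / 2) : ℝ) : ℂ)), h2, integral_smul]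

/-- Plancherel's theorem for the unitary Fourier integral with angular frequency. -/
theorem lintegral_enorm_sq_fourier {n m : ℕ} {H : Space n → Vec m} (h1 : Integrable H)
    (h2 : MemLp H 2) :
    ∫⁻ y : Space n, ‖(((2 * Real.pi) ^ (-(n : ℝ) / 2) : ℝ) : ℂ) •
      ∫ ξ, Complex.exp (Complex.I * (inner ℝ y ξ : ℝ)) • H ξ‖ₑ ^ 2 = ∫⁻ ξ, ‖H ξ‖ₑ ^ 2 := by
  have hpi : 0 < 2 * Real.pi := by positivity
  have hp : ∫⁻ ξ, ‖𝓕 H ξ‖ₑ ^ 2 = ∫⁻ ξ, ‖H ξ‖ₑ ^ 2 := by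
    have e := eLpNorm_fourier_eq h1 h2
    have a1 := eLpNorm_nnreal_pow_eq_lintegral (f := 𝓕 H) (μ := volume) (p := 2) two_ne_zero
    have a2 := eLpNorm_nnreal_pow_eq_lintegral (f := H) (μ := volume) (p := 2) two_ne_zero
    simp only [NNReal.coe_ofNat, ENNReal.rpow_ofNat, ENNReal.coe_ofNat] at a1 a2
    rw [← a1, ← a2, e]
  have hval : ∀ y : Space n, ∫ ξ, Complex.exp (Complex.I * (inner ℝ ((2 * Real.pi) • y) ξ : ℝ)) • H ξ
      = 𝓕 H (-y) := by
    intro y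
    rw [Real.fourier_eq']
    congr 1
    ext1 ξ
    rw [inner_neg_right, real_inner_smul_left, real_inner_comm]
    congr 2
    push_cast
    ring
  -- Substituting $2\pi y$ for $y$ produces the Jacobian $(2\pi)^n$, which cancels the square of the
  -- prefactor $(2\pi)^{-n/2}$.
  rw [lintegral_eq_mul_lintegral_comp_smul _ hpi]
  simp_rw [hval, enorm_smul, mul_pow (‖_‖ₑ)]
  rw [lintegral_const_mul' _ _ (by finiteness), lintegral_neg_eq_self (fun y => ‖𝓕 H y‖ₑ ^ 2), hp,
    ← mul_assoc]
  have hc : ‖(((2 * Real.pi) ^ (-(n : ℝ) / 2) : ℝ) : ℂ)‖ₑ =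
      ENNReal.ofReal ((2 * Real.pi) ^ (-(n : ℝ) / 2)) := by
    rw [← ofReal_norm, Complex.norm_real, Real.norm_of_nonneg (by positivity)]
  rw [hc, ← ENNReal.ofReal_pow (by positivity), ← ENNReal.ofReal_mul (by positivity)]
  have : (2 * Real.pi) ^ n * ((2 * Real.pi) ^ (-(n : ℝ) / 2)) ^ 2 = 1 := by
    rw [← Real.rpow_natCast, ← Real.rpow_natCast, ← Real.rpow_mul hpi.le, ← Real.rpow_add hpi]
    convert Real.rpow_zero _ using 2
    push_cast
    ring
  rw [this, ENNReal.ofReal_one, one_mul]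

/-! ### Low and high frequencies of the caloric extension -/

/-- The low-frequency part of the caloric extension. -/
theorem enorm_setIntegral_heatSymbol_le {n m : ℕ} {g : Space n → Vec m} {a : ℝ} {M : ℝ≥0}
    (hg : ∀ᵐ ξ, ‖g ξ‖ₑ ≤ M * ENNReal.ofReal (‖ξ‖ ^ (-a))) {t : ℝ} (ht : 0 < t) (y : Space n)
    (S : Set (Space n)) :
    ‖(((2 * Real.pi) ^ (-(n : ℝ) / 2) : ℝ) : ℂ) • ∫ ξ in S, heatSymbol t y ξ • g ξ‖ₑ ≤
      M * ∫⁻ ξ in S, ENNReal.ofReal (‖ξ‖ ^ (-a)) := by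
  have hc : ‖(((2 * Real.pi) ^ (-(n : ℝ) / 2) : ℝ) : ℂ)‖ₑ ≤ 1 := by
    rw [← ofReal_norm, Complex.norm_real, Real.norm_of_nonneg (by positivity), ENNReal.ofReal_le_one]
    refine Real.rpow_le_one_of_one_le_of_nonpos (by linarith [Real.pi_gt_three]) ?_
    rw [neg_div, neg_nonpos]
    positivity
  rw [enorm_smul]
  refine (mul_le_of_le_one_left' hc).trans ((enorm_integral_le_lintegral_enorm _).trans ?_)
  rw [← lintegral_const_mul' _ _ ENNReal.coe_ne_top]
  refine lintegral_mono_ae ?_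
  filter_upwards [ae_restrict_of_ae hg] with ξ hξ
  rw [enorm_smul]
  refine le_trans (mul_le_of_le_one_left' ?_) hξ
  rw [← ofReal_norm, norm_heatSymbol, ENNReal.ofReal_le_one, Real.exp_le_one_iff, neg_nonpos]
  positivity

/-- The high-frequency part of the caloric extension at a fixed time. -/
theorem lintegral_enorm_sq_setIntegral_heatSymbol_le {n m : ℕ} {g : Space n → Vec m}
    (hloc : LocallyIntegrable g) {a : ℝ} (ha : 0 ≤ a) {M : ℝ≥0}
    (hg : ∀ᵐ ξ, ‖g ξ‖ₑ ≤ M * ENNReal.ofReal (‖ξ‖ ^ (-a))) {t : ℝ} (ht : 0 < t) {r : ℝ}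
    (hr : 0 < r) :
    ∫⁻ y : Space n, ‖(((2 * Real.pi) ^ (-(n : ℝ) / 2) : ℝ) : ℂ) •
        ∫ ξ in (Metric.ball 0 r)ᶜ, heatSymbol t y ξ • g ξ‖ₑ ^ 2 ≤
      ∫⁻ ξ in (Metric.ball (0 : Space n) r)ᶜ, (M : ℝ≥0∞) ^ 2 *
        (ENNReal.ofReal (‖ξ‖ ^ (-(2 * a))) * ENNReal.ofReal (Real.exp (-(2 * ‖ξ‖ ^ 2) * t))) := by
  set S : Set (Space n) := (Metric.ball 0 r)ᶜ with hS
  have hSm : MeasurableSet S := measurableSet_ball.compl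
  set H : Space n → Vec m := S.indicator fun ξ => (Real.exp (-(t * ‖ξ‖ ^ 2)) : ℂ) • g ξ with hH
  -- Removing the ball makes `g` bounded, so the Gaussian puts `H` in every $L^p$; the modulation
  -- stays outside `H` as the Fourier character.
  have hmem : ∀ p : ℝ≥0∞, MemLp H p := fun p => by
    have hG : MemLp (fun ξ => (M * r ^ (-a)) * gaussian n t ht ξ) p :=
      ((gaussian n t ht).memLp p).const_mul _
    refine hG.of_le ?_ ?_
    · have hexp : Continuous fun ξ : Space n => (Real.exp (-(t * ‖ξ‖ ^ 2)) : ℂ) := by fun_prop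
      exact (hexp.aestronglyMeasurable.smul hloc.aestronglyMeasurable).indicator hSm
    · filter_upwards [ae_norm_le_of_notMem_ball ha hg hr] with ξ hξ
      have hgauss : gaussian n t ht ξ = Real.exp (-(t * ‖ξ‖ ^ 2)) := rfl
      rw [hgauss, Real.norm_of_nonneg (by positivity)]
      by_cases h2 : ξ ∈ S
      · rw [hH, Set.indicator_of_mem h2, norm_smul, Complex.norm_real,
          Real.norm_of_nonneg (by positivity), mul_comm]
        gcongr
        exact hξ h2
      · rw [hH, Set.indicator_of_notMem h2, norm_zero]
        positivity
  have hval : ∀ y, ∫ ξ in S, heatSymbol t y ξ • g ξ =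
      ∫ ξ, Complex.exp (Complex.I * (inner ℝ y ξ : ℝ)) • H ξ := fun y => by
    rw [← integral_indicator hSm]
    congr 1
    ext1 ξ
    by_cases h2 : ξ ∈ S
    · rw [hH, Set.indicator_of_mem h2, Set.indicator_of_mem h2, heatSymbol_eq_mul, smul_smul]
    · rw [hH, Set.indicator_of_notMem h2, Set.indicator_of_notMem h2, smul_zero]
  simp_rw [hval]
  rw [lintegral_enorm_sq_fourier (memLp_one_iff_integrable.1 (hmem 1)) (hmem 2),
    ← lintegral_indicator hSm]
  refine lintegral_mono_ae ?_
  filter_upwards [hg] with ξ hξ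
  by_cases h2 : ξ ∈ S
  · rw [hH, Set.indicator_of_mem h2, Set.indicator_of_mem h2, enorm_smul, ← ofReal_norm,
      Complex.norm_real, Real.norm_of_nonneg (by positivity)]
    have hξ0 : 0 < ‖ξ‖ := hr.trans_le (by simpa [hS] using h2)
    calc _ ≤ (ENNReal.ofReal (Real.exp (-(t * ‖ξ‖ ^ 2))) *
          (M * ENNReal.ofReal (‖ξ‖ ^ (-a)))) ^ 2 := by gcongr
      _ = (M : ℝ≥0∞) ^ 2 * (ENNReal.ofReal (‖ξ‖ ^ (-a)) ^ 2 *
          ENNReal.ofReal (Real.exp (-(t * ‖ξ‖ ^ 2))) ^ 2) := by ring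
      _ = _ := by
        rw [← ENNReal.ofReal_pow (by positivity), ← ENNReal.ofReal_pow (by positivity),
          ← Real.exp_nat_mul, ← Real.rpow_mul_natCast hξ0.le]
        congr 4 <;> push_cast <;> ring_nf
  · rw [hH, Set.indicator_of_notMem h2, Set.indicator_of_notMem h2]
    simp

/-- Integrating the square of the heat multiplier in time gains two powers of the frequency. -/
theorem lintegral_exp_neg_le {s : ℝ} (hs : 0 < s) (T : ℝ) :
    ∫⁻ t in Set.Ioo 0 T, ENNReal.ofReal (Real.exp (-(2 * s ^ 2) * t)) ≤
      ENNReal.ofReal (s ^ (-2 : ℝ)) := by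
  have hneg : -(2 * s ^ 2) < 0 := by
    have : 0 < s ^ 2 := by positivity
    linarith
  refine (lintegral_mono_set Set.Ioo_subset_Ioi_self).trans ?_
  rw [← ofReal_integral_eq_lintegral_ofReal (integrableOn_exp_mul_Ioi hneg 0)
    (.of_forall fun _ => (Real.exp_pos _).le), integral_exp_mul_Ioi hneg]
  refine ENNReal.ofReal_le_ofReal ?_
  rw [Real.rpow_neg hs.le, Real.rpow_ofNat, mul_zero, Real.exp_zero, neg_div_neg_eq, one_div]
  gcongr
  nlinarith [sq_nonneg s]

/-- The high-frequency part of the caloric extension, integrated in time. -/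
theorem lintegral_lintegral_highFrequency_le {n : ℕ} {a r : ℝ} (hr : 0 < r) (M : ℝ≥0) (T : ℝ) :
    ∫⁻ t in Set.Ioo 0 T, ∫⁻ ξ in (Metric.ball (0 : Space n) r)ᶜ, (M : ℝ≥0∞) ^ 2 *
        (ENNReal.ofReal (‖ξ‖ ^ (-(2 * a))) * ENNReal.ofReal (Real.exp (-(2 * ‖ξ‖ ^ 2) * t))) ≤
      (M : ℝ≥0∞) ^ 2 *
        ∫⁻ ξ in (Metric.ball (0 : Space n) r)ᶜ, ENNReal.ofReal (‖ξ‖ ^ (-(2 * a + 2))) := by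
  -- By Tonelli the time integral can be done first, at fixed frequency.
  rw [lintegral_lintegral_swap (Measurable.aemeasurable (by
    unfold Function.uncurry; fun_prop)), ← lintegral_const_mul' _ _ (by finiteness)]
  refine setLIntegral_mono' measurableSet_ball.compl fun ξ hξ => ?_
  have hξ0 : 0 < ‖ξ‖ := hr.trans_le (by simpa using hξ)
  rw [lintegral_const_mul' _ _ (by finiteness), lintegral_const_mul' _ _ (by finiteness),
    neg_add, Real.rpow_add hξ0, ENNReal.ofReal_mul (by positivity)]
  gcongr
  exact lintegral_exp_neg_le hξ0 T

theorem add_sq_le_four_mul (a b : ℝ≥0∞) : (a + b) ^ 2 ≤ 4 * a ^ 2 + 4 * b ^ 2 := by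
  have key : ∀ a b : ℝ≥0∞, a ≤ b → (a + b) ^ 2 ≤ 4 * a ^ 2 + 4 * b ^ 2 := fun a b h =>
    calc (a + b) ^ 2 ≤ (b + b) ^ 2 := by gcongr
      _ = 4 * b ^ 2 := by ring
      _ ≤ _ := le_add_self
  rcases le_total a b with h | h
  · exact key a b h
  · rw [add_comm a, add_comm (4 * a ^ 2)]
    exact key b a h

/-- The space-time integral of the caloric extension over a parabolic cylinder, split at the
frequency `r`. -/
theorem lintegral_heat_sq_le {n m : ℕ} {f : 𝓢'(Space n, Vec m)} {g : Space n → Vec m}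
    (hf : IsFunction (fourierDist f) g) {a : ℝ} (ha : 0 ≤ a) {M : ℝ≥0}
    (hg : ∀ᵐ ξ, ‖g ξ‖ₑ ≤ M * ENNReal.ofReal (‖ξ‖ ^ (-a))) (x : Space n) (R T : ℝ) {r : ℝ}
    (hr : 0 < r) :
    ∫⁻ t in Set.Ioo 0 T, ∫⁻ y in Metric.ball x R, ‖heat f t y‖ₑ ^ 2 ≤
      4 * (M * ∫⁻ ξ in Metric.ball (0 : Space n) r, ENNReal.ofReal (‖ξ‖ ^ (-a))) ^ 2 *
          volume (Metric.ball x R) * ENNReal.ofReal T +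
        4 * ((M : ℝ≥0∞) ^ 2 *
          ∫⁻ ξ in (Metric.ball (0 : Space n) r)ᶜ, ENNReal.ofReal (‖ξ‖ ^ (-(2 * a + 2)))) := by
  set L : ℝ≥0∞ := M * ∫⁻ ξ in Metric.ball (0 : Space n) r, ENNReal.ofReal (‖ξ‖ ^ (-a)) with hL
  have hpt : ∀ t ∈ Set.Ioo 0 T, ∫⁻ y in Metric.ball x R, ‖heat f t y‖ₑ ^ 2 ≤
      4 * L ^ 2 * volume (Metric.ball x R) +
        4 * ∫⁻ ξ in (Metric.ball (0 : Space n) r)ᶜ, (M : ℝ≥0∞) ^ 2 *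
        (ENNReal.ofReal (‖ξ‖ ^ (-(2 * a))) *
          ENNReal.ofReal (Real.exp (-(2 * ‖ξ‖ ^ 2) * t))) := by
    rintro t ⟨ht, -⟩
    refine le_trans (lintegral_mono (g := fun y => 4 * L ^ 2 +
      4 * ‖(((2 * Real.pi) ^ (-(n : ℝ) / 2) : ℝ) : ℂ) •
        ∫ ξ in (Metric.ball 0 r)ᶜ, heatSymbol t y ξ • g ξ‖ₑ ^ 2) fun y => ?_) ?_
    · rw [heat_eq_integral hf ha hg ht,
        ← integral_add_compl (measurableSet_ball (x := 0) (ε := r))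
          (integrable_heatSymbol_smul hf.1 ha hg ht y), smul_add]
      refine le_trans (pow_le_pow_left' (enorm_add_le _ _) 2) ((add_sq_le_four_mul _ _).trans ?_)
      exact add_le_add_left (mul_le_mul_right (pow_le_pow_left'
        (enorm_setIntegral_heatSymbol_le hg ht y _) 2) 4) _
    · rw [lintegral_add_left measurable_const, setLIntegral_const,
        lintegral_const_mul' _ _ (by finiteness)]
      refine add_le_add_right (mul_le_mul_right ?_ 4) _
      -- The ball in $y$ is enlarged to the whole space so that Plancherel applies.
      exact (setLIntegral_le_lintegral _ _).trans
        (lintegral_enorm_sq_setIntegral_heatSymbol_le hf.1 ha hg ht hr)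
  refine (setLIntegral_mono' measurableSet_Ioo hpt).trans ?_
  rw [lintegral_add_left measurable_const, setLIntegral_const, Real.volume_Ioo, sub_zero,
    lintegral_const_mul' _ _ (by finiteness)]
  gcongr
  exact lintegral_lintegral_highFrequency_le hr M T

/-! ### Carleson bounds by the pseudomeasure norm -/

/-- The Carleson functional is controlled by the size of the Fourier transform. -/
theorem exists_carleson_le (n m : ℕ) (hn : 1 ≤ n) {θ : ℝ} (hθ : 0 < θ) (hθn : θ ≤ n)
    (hθ' : 2 * θ < n + 2) :
    ∃ K : ℝ≥0, 0 < K ∧ ∀ (f : 𝓢'(Space n, Vec m)) (g : Space n → Vec m) (M : ℝ≥0),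
      IsFunction (fourierDist f) g →
      (∀ᵐ ξ, ‖g ξ‖ₑ ≤ M * ENNReal.ofReal (‖ξ‖ ^ (-((n : ℝ) - θ)))) → ∀ (x : Space n) (R : ℝ),
      0 < R → carleson f x R ≤ K * ENNReal.ofReal (R ^ (1 - θ)) * M := by
  obtain ⟨A, hA⟩ := exists_setLIntegral_ball_norm_rpow hn (b := n - θ) (by linarith)
  obtain ⟨A', hA'⟩ := exists_setLIntegral_compl_ball_norm_rpow hn (b := 2 * (n - θ) + 2)
    (by linarith)
  set v : ℝ≥0 := (volume (Metric.ball (0 : Space n) 1)).toNNReal with hv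
  have hvtop : volume (Metric.ball (0 : Space n) 1) ≠ ∞ := measure_ball_lt_top.ne
  have hv0 : v ≠ 0 := (ENNReal.toNNReal_pos (Metric.measure_ball_pos _ _ one_pos).ne' hvtop).ne'
  -- `A` comes from the low frequencies and `A'` with $v^{-1}$ from the high ones; the summand $1$
  -- only makes the constant positive.
  refine ⟨NNReal.sqrt (4 * A ^ 2 + 4 * A' * v⁻¹ + 1), NNReal.sqrt_pos.2 (by positivity),
    fun f g M hf hg x R hR => ?_⟩
  have hvol : volume (Metric.ball x R) = ENNReal.ofReal (R ^ n) * v := by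
    rw [Measure.addHaar_ball_of_pos _ _ hR, finrank_euclideanSpace_fin, hv,
      ENNReal.coe_toNNReal hvtop]
  have hvol0 : volume (Metric.ball x R) ≠ 0 := (Metric.measure_ball_pos _ _ hR).ne'
  have hvolt : volume (Metric.ball x R) ≠ ∞ := measure_ball_lt_top.ne
  -- The frequency cut at $1/R$ is the parabolic scale of the time interval $(0,R^2)$.
  have h1 := lintegral_heat_sq_le hf (by linarith) hg x R (R ^ 2) (inv_pos.2 hR)
  rw [hA _ (inv_pos.2 hR), hA' _ (inv_pos.2 hR)] at h1
  have hlow : ENNReal.ofReal (R⁻¹ ^ ((n : ℝ) - (n - θ))) ^ 2 * ENNReal.ofReal (R ^ 2) =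
      ENNReal.ofReal (R ^ (1 - θ)) ^ 2 := by
    rw [← ENNReal.ofReal_pow (by positivity), ← ENNReal.ofReal_mul (by positivity),
      ← ENNReal.ofReal_pow (by positivity), ← mul_pow, sub_sub_cancel, Real.inv_rpow hR.le,
      Real.rpow_sub hR, Real.rpow_one, div_eq_inv_mul]
  have hhigh : ENNReal.ofReal (R⁻¹ ^ ((n : ℝ) - (2 * (n - θ) + 2))) =
      ENNReal.ofReal (R ^ (1 - θ)) ^ 2 * ENNReal.ofReal (R ^ n) := by
    rw [← ENNReal.ofReal_pow (by positivity), ← ENNReal.ofReal_mul (by positivity),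
      Real.inv_rpow hR.le, ← Real.rpow_neg hR.le, ← Real.rpow_natCast, ← Real.rpow_natCast,
      ← Real.rpow_mul hR.le, ← Real.rpow_add hR]
    congr 2
    push_cast
    ring
  set P : ℝ≥0∞ := ENNReal.ofReal (R ^ (1 - θ)) with hP
  have hRv : ENNReal.ofReal (R ^ n) = (v : ℝ≥0∞)⁻¹ * volume (Metric.ball x R) := by
    rw [hvol, mul_comm, mul_assoc, ENNReal.mul_inv_cancel (ENNReal.coe_ne_zero.2 hv0)
      ENNReal.coe_ne_top, mul_one]
  have h2 : (volume (Metric.ball x R))⁻¹ *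
      ∫⁻ t in Set.Ioo 0 (R ^ 2), ∫⁻ y in Metric.ball x R, ‖heat f t y‖ₑ ^ 2 ≤
      (NNReal.sqrt (4 * A ^ 2 + 4 * A' * v⁻¹ + 1) * P * M) ^ 2 := by
    refine (mul_le_mul_right h1 _).trans ?_
    calc
      _ = (volume (Metric.ball x R))⁻¹ * volume (Metric.ball x R) *
          ((4 * A ^ 2 + 4 * A' * (v : ℝ≥0∞)⁻¹) * P ^ 2 * M ^ 2) := by
        rw [hhigh, hRv, ← hlow]; ring
      _ = (4 * A ^ 2 + 4 * A' * (v : ℝ≥0∞)⁻¹) * P ^ 2 * M ^ 2 := by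
        rw [ENNReal.inv_mul_cancel hvol0 hvolt, one_mul]
      _ ≤ (4 * A ^ 2 + 4 * A' * (v : ℝ≥0∞)⁻¹ + 1) * P ^ 2 * M ^ 2 := by
        have hle : 4 * (A : ℝ≥0∞) ^ 2 + 4 * A' * (v : ℝ≥0∞)⁻¹ ≤
            4 * (A : ℝ≥0∞) ^ 2 + 4 * A' * (v : ℝ≥0∞)⁻¹ + 1 := le_self_add
        exact mul_le_mul_left (mul_le_mul_left hle _) _
      _ = _ := by
        rw [mul_pow, mul_pow, ← ENNReal.coe_pow (NNReal.sqrt _), NNReal.sq_sqrt]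
        push_cast [ENNReal.coe_inv hv0]
        rfl
  rw [carleson]
  calc _ ≤ ((NNReal.sqrt (4 * A ^ 2 + 4 * A' * v⁻¹ + 1) * P * M : ℝ≥0∞) ^ 2) ^ (1 / 2 : ℝ) :=
        ENNReal.rpow_le_rpow h2 (by norm_num)
    _ = _ := by
      rw [← ENNReal.rpow_natCast, ← ENNReal.rpow_mul]
      norm_num

/-- The Carleson functional is controlled by the pseudomeasure norm. -/
theorem exists_carleson_le_pmNorm (n m : ℕ) (hn : 1 ≤ n) {θ : ℝ} (hθ : 0 < θ) (hθn : θ ≤ n)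
    (hθ' : 2 * θ < n + 2) :
    ∃ K : ℝ≥0, ∀ (f : 𝓢'(Space n, Vec m)) (x : Space n) (R : ℝ), 0 < R →
      carleson f x R ≤ K * ENNReal.ofReal (R ^ (1 - θ)) * pmNorm ((n : ℝ) - θ) f := by
  obtain ⟨K, hK0, hK⟩ := exists_carleson_le n m hn hθ hθn hθ'
  have : NeZero n := ⟨by omega⟩
  have hae : ∀ᵐ ξ : Space n, ξ ≠ 0 := by simp [ae_iff, measure_singleton]
  refine ⟨K, fun f x R hR => ?_⟩
  -- A nonzero finite factor passes through the infimum over representatives.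
  have hc0 : (K : ℝ≥0∞) * ENNReal.ofReal (R ^ (1 - θ)) ≠ 0 :=
    mul_ne_zero (by exact_mod_cast hK0.ne') (by simpa using Real.rpow_pos_of_pos hR _)
  have hct : (K : ℝ≥0∞) * ENNReal.ofReal (R ^ (1 - θ)) ≠ ∞ := by finiteness
  unfold pmNorm
  simp_rw [ENNReal.mul_iInf_of_ne hc0 hct]
  refine le_iInf₂ fun g hg => ?_
  set N := essSup (fun ξ : Space n => ENNReal.ofReal (‖ξ‖ ^ ((n : ℝ) - θ)) * ‖g ξ‖ₑ) volume with hN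
  rcases eq_or_ne N ∞ with htop | htop
  · rw [htop, ENNReal.mul_top hc0]; exact le_top
  have h1 := hK f g N.toNNReal hg ?_ x R hR
  · rwa [ENNReal.coe_toNNReal htop] at h1
  rw [ENNReal.coe_toNNReal htop]
  filter_upwards [hae, ENNReal.ae_le_essSup
    (fun ξ : Space n => ENNReal.ofReal (‖ξ‖ ^ ((n : ℝ) - θ)) * ‖g ξ‖ₑ)] with ξ hξ h2
  have hξ0 : 0 < ‖ξ‖ := norm_pos_iff.2 hξ
  calc ‖g ξ‖ₑ = ENNReal.ofReal (‖ξ‖ ^ ((n : ℝ) - θ) * ‖ξ‖ ^ (-((n : ℝ) - θ))) * ‖g ξ‖ₑ := by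
        rw [← Real.rpow_add hξ0]; simp
    _ = (ENNReal.ofReal (‖ξ‖ ^ ((n : ℝ) - θ)) * ‖g ξ‖ₑ) *
          ENNReal.ofReal (‖ξ‖ ^ (-((n : ℝ) - θ))) := by
        rw [ENNReal.ofReal_mul (by positivity)]; ring
    _ ≤ _ := by gcongr

/-- The local `BMO⁻¹` norm is controlled by the pseudomeasure norm. -/
theorem exists_bmoInvNormLocal_le_pmNorm (n m : ℕ) (hn : 1 ≤ n) {θ : ℝ} (hθ : 0 < θ)
    (hθ1 : θ ≤ 1) :
    ∃ C : ℝ≥0, ∀ T : ℝ, 0 < T → ∀ f : 𝓢'(Space n, Vec m),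
      bmoInvNormLocal T f ≤ C * ENNReal.ofReal (T ^ ((1 - θ) / 2)) * pmNorm ((n : ℝ) - θ) f := by
  have hn' : (1 : ℝ) ≤ n := by exact_mod_cast hn
  obtain ⟨K, hK⟩ := exists_carleson_le_pmNorm n m hn hθ (by linarith) (by linarith)
  refine ⟨K, fun T hT f => ?_⟩
  refine iSup_le fun x => iSup_le fun R => iSup₂_le fun hR hRT => (hK f x R hR).trans ?_
  gcongr
  -- Monotonicity in $R^2<T$ is where $\theta\le1$ enters.
  calc R ^ (1 - θ) = (R ^ 2) ^ ((1 - θ) / 2) := by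
        rw [← Real.rpow_natCast, ← Real.rpow_mul hR.le]
        congr 1
        push_cast
        ring
    _ ≤ T ^ ((1 - θ) / 2) := Real.rpow_le_rpow (by positivity) hRT.le (by linarith)

theorem continuouslyEmbeds_of_le {n m : ℕ} {N₁ N₂ : 𝓢'(Space n, Vec m) → ℝ≥0∞} {C : ℝ≥0}
    (h : ∀ f, N₂ f ≤ C * N₁ f) : ContinuouslyEmbeds N₁ N₂ :=
  ⟨fun f hf => (h f).trans_lt (ENNReal.mul_lt_top ENNReal.coe_lt_top hf), C, fun f _ => h f⟩

end Majorization

end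

theorem mainTheorem4 (n m : ℕ) (hn : 2 ≤ n) :
    -- the case `θ = 1`
    ((∀ (α ω : ℝ) (h : Majorization.Space n → ℝ≥0∞),
        Majorization.IsRadialAlgebraicKernel n 1 α ω h →
          Majorization.ContinuouslyEmbeds (n := n) (m := m)
            (Majorization.majorizationNorm h) (Majorization.pmNorm ((n : ℝ) - 1))) ∧
      Majorization.ContinuouslyEmbeds (n := n) (m := m)
        (Majorization.pmNorm ((n : ℝ) - 1)) Majorization.bmoInvNorm) ∧
    -- the case `0 < θ < 1`
    ∀ θ : ℝ, 0 < θ → θ < 1 →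
      (∀ (α ω : ℝ) (h : Majorization.Space n → ℝ≥0∞),
        Majorization.IsRadialAlgebraicKernel n θ α ω h →
          Majorization.ContinuouslyEmbeds (n := n) (m := m)
            (Majorization.majorizationNorm h) (Majorization.pmNorm ((n : ℝ) - θ))) ∧
      (∀ T : ℝ, 0 < T →
        Majorization.ContinuouslyEmbeds (n := n) (m := m)
          (Majorization.pmNorm ((n : ℝ) - θ)) (Majorization.bmoInvNormLocal T)) ∧
      ∃ C : ℝ≥0, ∀ T : ℝ, 0 < T →
        ∀ f : 𝓢'(Majorization.Space n, Majorization.Vec m),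
          Majorization.pmNorm ((n : ℝ) - θ) f < ∞ →
            Majorization.bmoInvNormLocal T f ≤
              C * ENNReal.ofReal (T ^ ((1 - θ) / 2)) * Majorization.pmNorm ((n : ℝ) - θ) f := by
  have hn1 : 1 ≤ n := by omega
  have hn' : (2 : ℝ) ≤ n := by exact_mod_cast hn
  have hker : ∀ (θ : ℝ), θ ≤ 1 → ∀ (α ω : ℝ) (h : Majorization.Space n → ℝ≥0∞),
      Majorization.IsRadialAlgebraicKernel n θ α ω h →
        Majorization.ContinuouslyEmbeds (n := n) (m := m)
          (Majorization.majorizationNorm h) (Majorization.pmNorm ((n : ℝ) - θ)) := by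
    intro θ hθ α ω h H
    obtain ⟨C, hC⟩ := H.le_rpow hn1 (by linarith)
    exact Majorization.continuouslyEmbeds_majorization_pm hn1 H.pos hC
  refine ⟨⟨hker 1 le_rfl, ?_⟩, fun θ hθ hθ1 => ⟨hker θ hθ1.le, ?_⟩⟩
  · obtain ⟨K, hK⟩ := Majorization.exists_carleson_le_pmNorm n m hn1 one_pos (by linarith)
      (by linarith)
    refine Majorization.continuouslyEmbeds_of_le (C := K) fun f =>
      iSup_le fun x => iSup₂_le fun R hR => ?_
    -- At $\theta=1$ the factor $R^{1-\theta}$ is $1$, so all radii are allowed.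
    simpa using hK f x R hR
  · obtain ⟨C, hC⟩ := Majorization.exists_bmoInvNormLocal_le_pmNorm n m hn1 hθ hθ1.le
    refine ⟨fun T hT => ?_, C, fun T hT f _ => hC T hT f⟩
    exact Majorization.continuouslyEmbeds_of_le (C := C * (T ^ ((1 - θ) / 2)).toNNReal)
      fun f => by simpa [ENNReal.ofReal] using hC T hT f
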